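/- **Setting.** For $\rho\in\mathbb R$ put $z(\rho)=\dfrac{\frac12+i\rho}{\frac12-i\rho}$ and $e_k(\rho)=\dfrac{z(\rho)^k}{\frac12-i\rho}$, $k=0,1,2,\dots$. Let $L_2^+(\mathbb R)=P^+(L_2(\mathbb R))\subset L_2(\mathbb R)$ (complex-valued functions), where $(P^+f)(\rho)=\lim_{\varepsilon\to0+}\frac1{2\pi i}\int_{-\infty}^{\infty}\frac{f(\tau)\,d\tau}{\tau-(\rho+i\varepsilon)}$ for almost every $\rho$. For a continuous function $\varphi$ on the one-point compactification $\dot{\mathbb R}=\mathbb R\cup\{\infty\}$, let $\mathbf H(\varphi)$ be the bounded Hankel operator on $L_2^+(\mathbb R)$ given by $$(\mathbf H(\varphi)y)(\rho)=\lim_{\varepsilon\to0+}\frac1{2\pi i}\int_{-\infty}^\infty\frac{\varphi(\tau)y(\tau)}{\tau+(\rho+i\varepsilon)}\,d\tau\qquad\text{for a.e. }\rho\in\mathbb R .$$ Let $P_n$ be the projection $\sum_{k\ge0}f_ke_k\mapsto\sum_{k<n}f_ke_k$ of $L_2^+(\mathbb R)$ onto $L_2^{+(n)}=\operatorname{span}\{e_0,\dots,e_{n-1}\}$,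 and put $$h_p=\frac{(-1)^{p+1}}{2\pi}\int_{-\infty}^\infty\frac{\varphi(\tau)z(\tau)^{p+1}}{(\frac12-i\tau)(\frac12+i\tau)}\,d\tau ,\qquad p\ge 0 .$$ In terms of the coefficients of $y=\sum_{k\ge0}(-1)^ka_ke_k$ and $f=\sum_{m\ge0}(-1)^mr_me_m$, the equation $(I+\mathbf H(\varphi))y=f$ is the infinite system $$a_m+\sum_{k=0}^\infty h_{k+m}a_k=r_m,\qquad m=0,1,2,\dots\tag{$*$}$$ **Theorem.** Let $\varphi\in C(\dot{\mathbb R})$ and let $I+\mathbf H(\varphi)$ be invertible on $L_2^+(\mathbb R)$. Then the finite section method is applicable to $I+\mathbf H(\varphi)$ and to the system $(*)$ in $L_2^+(\mathbb R)$, that is: 1. There are $N$ and $C$ such that for all $n\ge N$ the operator $P_n(I+\mathbf H(\varphi))P_n$ is invertible on $L_2^{+(n)}$, with inverse of norm at most $C$; and for every $f\in L_2^+(\mathbb R)$ the functions $\left(P_n(I+\mathbf H(\varphi))P_n\right)^{-1}P_nf$ converge in the $L_2$-norm, as $n\to\infty$, to the solution $y$ of $(I+\mathbf H(\varphi))y=f$.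 2. For all sufficiently large $n$ the reduced system $a^{(n)}_m+\sum_{k=0}^{n-1}h_{k+m}a^{(n)}_k=r_m$, $0\le m<n$, has exactly one solution, whatever the numbers $r_0,\dots,r_{n-1}$ are. 3. For every $(r_m)_{m\ge0}\in\ell_2$ the system $(*)$ has exactly one solution $(a_k)_{k\ge0}\in\ell_2$; the series $y=\sum_{k\ge0}(-1)^ka_ke_k$ converges in $L_2^+(\mathbb R)$, and the solutions of the reduced systems satisfy $\sum_{k<n}(-1)^ka^{(n)}_ke_k\to y$ in the $L_2$-norm as $n\to\infty$. 4. If $\varphi\in L_2(\mathbb R)$, the right-hand side of the system that comes from the equation $(I+\mathbf H(\varphi))y=-\mathbf H(\varphi)(1)$, namely $r_m=\frac{(-1)^m}{2\pi}\int_{-\infty}^\infty\frac{\varphi(\tau)z(\tau)^{m+1}}{\frac12+i\tau}\,d\tau$, belongs to $\ell_2$, so that 3 applies to it. -/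

import Mathlib

open MeasureTheory Filter Topology ComplexConjugate

namespace HankelSection

/-- The complex Hilbert space `L₂(ℝ)`. -/
abbrev L2 : Type := Lp ℂ 2 (volume : Measure ℝ)

/-- The Cauchy integral `(1/2πi) ∫ f(τ) / (τ - w) dτ`. -/
noncomputable def cauchyIntegral (f : ℝ → ℂ) (w : ℂ) : ℂ :=
  (2 * Real.pi * Complex.I)⁻¹ * ∫ τ : ℝ, f τ / ((τ : ℂ) - w)

theorem integrable_poisson (a b : ℝ) (hb : b ≠ 0) :
    Integrable (fun τ : ℝ => ((τ - a) ^ 2 + b ^ 2)⁻¹) := by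
  have h := ((integrable_inv_one_add_sq.comp_div hb).comp_sub_right a).const_mul ((b ^ 2)⁻¹)
  refine h.congr (ae_of_all _ fun τ => ?_)
  simp only
  rw [← mul_inv]
  congr 1
  field_simp
  ring

theorem normSq_sub (τ : ℝ) (w : ℂ) : ‖(τ : ℂ) - w‖ ^ 2 = (τ - w.re) ^ 2 + w.im ^ 2 := by
  rw [Complex.sq_norm, Complex.normSq_apply]
  simp
  ring

theorem sub_ne (τ : ℝ) {w : ℂ} (hw : w.im ≠ 0) : (τ : ℂ) - w ≠ 0 := by
  intro h
  apply hw
  have := congrArg Complex.im h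
  simpa using this

theorem memLp_kernel {w : ℂ} (hw : w.im ≠ 0) :
    MemLp (fun τ : ℝ => ((τ : ℂ) - w)⁻¹) 2 := by
  have hc : Continuous (fun τ : ℝ => ((τ : ℂ) - w)⁻¹) :=
    Continuous.inv₀ (by fun_prop) fun τ => sub_ne τ hw
  rw [memLp_two_iff_integrable_sq_norm hc.aestronglyMeasurable]
  refine (integrable_poisson w.re w.im hw).congr (ae_of_all _ fun τ => ?_)
  simp only
  rw [norm_inv, inv_pow, normSq_sub]

/-- The Cauchy kernel `τ ↦ 1 / (τ - w)` as an element of `L₂(ℝ)`. -/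
noncomputable def kernelL2 (w : ℂ) (hw : w.im ≠ 0) : L2 := (memLp_kernel hw).toLp _

theorem conj_im_ne {w : ℂ} (hw : w.im ≠ 0) : (conj w).im ≠ 0 := by simpa using hw

theorem inner_kernelL2 (f : L2) (w : ℂ) (hw : w.im ≠ 0) :
    inner ℂ (kernelL2 (conj w) (conj_im_ne hw)) f = ∫ τ : ℝ, f τ / ((τ : ℂ) - w) := by
  rw [L2.inner_def]
  refine integral_congr_ae ?_
  filter_upwards [(memLp_kernel (conj_im_ne hw)).coeFn_toLp] with τ hτ
  rw [kernelL2, hτ]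
  simp [RCLike.inner_apply, div_eq_mul_inv]

theorem cauchyIntegral_eq_inner (f : L2) (w : ℂ) (hw : w.im ≠ 0) :
    cauchyIntegral f w = (2 * Real.pi * Complex.I)⁻¹ *
      inner ℂ (kernelL2 (conj w) (conj_im_ne hw)) f := by
  rw [inner_kernelL2 f w hw, cauchyIntegral]

theorem integrable_div_sub (f : L2) (w : ℂ) (hw : w.im ≠ 0) :
    Integrable (fun τ : ℝ => f τ / ((τ : ℂ) - w)) := by
  refine (L2.integrable_inner (𝕜 := ℂ) (kernelL2 (conj w) (conj_im_ne hw)) f).congr ?_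
  filter_upwards [(memLp_kernel (conj_im_ne hw)).coeFn_toLp] with τ hτ
  rw [kernelL2, hτ]
  simp [RCLike.inner_apply, div_eq_mul_inv]

/-- The Möbius variable `z(ρ) = (1/2 + iρ) / (1/2 - iρ)`. -/
noncomputable def z (ρ : ℝ) : ℂ := (1 / 2 + Complex.I * ρ) / (1 / 2 - Complex.I * ρ)

/-- The function `e_k(ρ) = z(ρ)^k / (1/2 - iρ)`. -/
noncomputable def basisFun (k : ℕ) (ρ : ℝ) : ℂ := z ρ ^ k / (1 / 2 - Complex.I * ρ)

theorem den_ne (ρ : ℝ) : (1 / 2 - Complex.I * ρ : ℂ) ≠ 0 := by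
  intro h
  have := congrArg Complex.re h
  simp at this

theorem num_ne (ρ : ℝ) : (1 / 2 + Complex.I * ρ : ℂ) ≠ 0 := by
  intro h
  have := congrArg Complex.re h
  simp at this

theorem norm_z (ρ : ℝ) : ‖z ρ‖ = 1 := by
  have : (1 / 2 + Complex.I * ρ : ℂ) = conj (1 / 2 - Complex.I * ρ : ℂ) := by
    simp [Complex.conj_ofNat]
  rw [z, norm_div, this, Complex.norm_conj, div_self (norm_ne_zero_iff.2 (den_ne ρ))]

theorem continuous_z : Continuous z :=
  Continuous.div (by fun_prop) (by fun_prop) den_ne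

theorem den_eq (ρ : ℝ) : (1 / 2 - Complex.I * ρ : ℂ)⁻¹ =
    Complex.I * ((ρ : ℂ) - (-(Complex.I / 2)))⁻¹ := by
  have h : (ρ : ℂ) - (-(Complex.I / 2)) ≠ 0 := sub_ne ρ (by norm_num)
  have h2 := den_ne ρ
  rw [eq_comm, ← div_eq_mul_inv, div_eq_iff h, ← div_eq_inv_mul, eq_div_iff h2]
  linear_combination (-ρ : ℂ) * Complex.I_sq

theorem memLp_zpow_mul (k : ℕ) {f : ℝ → ℂ} (hf : MemLp f 2) :
    MemLp (fun ρ => z ρ ^ k * f ρ) 2 := by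
  refine hf.of_le ((continuous_z.pow k).aestronglyMeasurable.mul hf.1)
    (ae_of_all _ fun ρ => ?_)
  simp [norm_z]

theorem memLp_basisFun (k : ℕ) : MemLp (basisFun k) 2 := by
  have h := memLp_zpow_mul k ((memLp_kernel (w := -(Complex.I / 2)) (by norm_num)).const_mul Complex.I)
  refine h.congr_norm ?_ (ae_of_all _ fun ρ => ?_)
  · exact ((continuous_z.pow k).div (by fun_prop) den_ne).aestronglyMeasurable
  · simp only [basisFun, div_eq_mul_inv (z ρ ^ k), den_eq]

/-- The function `e_k` as an element of `L₂(ℝ)`. -/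
noncomputable def basisL2 (k : ℕ) : L2 := (memLp_basisFun k).toLp _

theorem hasDerivAt_z (ρ : ℝ) : HasDerivAt z (Complex.I / (1 / 2 - Complex.I * ρ) ^ 2) ρ := by
  have hid : HasDerivAt (fun ρ : ℝ => (ρ : ℂ)) 1 ρ := Complex.ofRealCLM.hasDerivAt
  have h1 : HasDerivAt (fun ρ : ℝ => (1 / 2 + Complex.I * ρ : ℂ)) (Complex.I * 1) ρ :=
    (hid.const_mul Complex.I).const_add _
  have h2 : HasDerivAt (fun ρ : ℝ => (1 / 2 - Complex.I * ρ : ℂ)) (-(Complex.I * 1)) ρ :=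
    (hid.const_mul Complex.I).const_sub _
  refine (h1.div h2 (den_ne ρ)).congr_deriv ?_
  congr 1
  ring

theorem tendsto_z (l : Filter ℝ) (hl : Tendsto (fun ρ : ℝ => |ρ|) l atTop) :
    Tendsto z l (𝓝 (-1)) := by
  have h1 : Tendsto (fun ρ : ℝ => (1 / 2 - Complex.I * ρ : ℂ)⁻¹) l (𝓝 0) := by
    rw [tendsto_zero_iff_norm_tendsto_zero]
    refine squeeze_zero' (Eventually.of_forall fun _ => norm_nonneg _) ?_
      (tendsto_inv_atTop_zero.comp hl)
    filter_upwards [hl.eventually_gt_atTop 0] with ρ h0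
    rw [norm_inv, Function.comp]
    apply inv_anti₀ h0
    have := Complex.abs_im_le_norm (1 / 2 - Complex.I * ρ : ℂ)
    simpa using this
  have h2 : z = fun ρ : ℝ => -1 + (1 / 2 - Complex.I * ρ : ℂ)⁻¹ := by
    funext ρ
    rw [z, div_eq_iff (den_ne ρ), add_mul, inv_mul_cancel₀ (den_ne ρ)]
    ring
  rw [h2]
  simpa using h1.const_add (-1)


theorem integrable_zpow_den (n : ℕ) :
    Integrable (fun ρ : ℝ => z ρ ^ n * (1 / (1 / 2 - Complex.I * ρ : ℂ) ^ 2)) := by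
  have h := (memLp_basisFun n).integrable_mul (memLp_basisFun 0)
  refine h.congr (ae_of_all _ fun ρ => ?_)
  have := den_ne ρ
  simp only [basisFun, Pi.mul_apply]
  field_simp

theorem integral_zpow_den (n : ℕ) :
    ∫ ρ : ℝ, z ρ ^ n * (1 / (1 / 2 - Complex.I * ρ : ℂ) ^ 2) = 0 := by
  have hc : ((n + 1 : ℂ) * Complex.I) ≠ 0 :=
    mul_ne_zero (by exact_mod_cast n.succ_ne_zero) Complex.I_ne_zero
  have hd : ∀ ρ : ℝ, HasDerivAt (fun ρ => ((n + 1 : ℂ) * Complex.I)⁻¹ * z ρ ^ (n + 1))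
      (z ρ ^ n * (1 / (1 / 2 - Complex.I * ρ : ℂ) ^ 2)) ρ := fun ρ => by
    refine (((hasDerivAt_z ρ).pow (n + 1)).const_mul _).congr_deriv ?_
    have := den_ne ρ
    have hn : (n + 1 : ℂ) ≠ 0 := by exact_mod_cast n.succ_ne_zero
    have hI := Complex.I_ne_zero
    simp only [Nat.add_sub_cancel, Nat.cast_add, Nat.cast_one]
    field_simp
  have hlim : ∀ l : Filter ℝ, Tendsto (fun ρ : ℝ => |ρ|) l atTop →
      Tendsto (fun ρ => ((n + 1 : ℂ) * Complex.I)⁻¹ * z ρ ^ (n + 1)) l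
        (𝓝 (((n + 1 : ℂ) * Complex.I)⁻¹ * (-1) ^ (n + 1))) := fun l hl =>
    ((tendsto_z l hl).pow _).const_mul _
  rw [integral_of_hasDerivAt_of_tendsto hd (integrable_zpow_den n)
    (hlim _ tendsto_abs_atBot_atTop) (hlim _ tendsto_abs_atTop_atTop), sub_self]

/-- The closed linear span of the functions `e_k`, `k ≥ 0`. -/
noncomputable def closedSpan : Submodule ℂ L2 :=
  (Submodule.span ℂ (Set.range basisL2)).topologicalClosure

theorem basisL2_mem_closedSpan (k : ℕ) : basisL2 k ∈ closedSpan :=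
  Submodule.le_topologicalClosure _ (Submodule.subset_span ⟨k, rfl⟩)

theorem kernelL2_mem_closedSpan {w : ℂ} (hw : w.im < 0) : kernelL2 w hw.ne ∈ closedSpan := by
  set a : ℂ := (1 / 2 - Complex.I * w) / (1 / 2 + Complex.I * w) with ha
  have hd : (1 / 2 + Complex.I * w : ℂ) ≠ 0 := by
    intro h
    have := congrArg Complex.re h
    simp at this
    linarith
  have hna : ‖a‖ < 1 := by
    rw [ha, norm_div, div_lt_one (norm_pos_iff.2 hd), ← sq_lt_sq₀ (norm_nonneg _) (norm_nonneg _),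
      Complex.sq_norm, Complex.sq_norm, Complex.normSq_apply, Complex.normSq_apply]
    simp
    nlinarith
  set c : ℂ := -Complex.I * (1 + a) with hc
  have key : ∀ ρ : ℝ, ((ρ : ℂ) - w)⁻¹ * (1 - a * z ρ) = c * (1 / 2 - Complex.I * ρ : ℂ)⁻¹ := by
    intro ρ
    have h1 := sub_ne ρ hw.ne
    have h2 := den_ne ρ
    have h3 : a * (1 / 2 + Complex.I * w) = 1 / 2 - Complex.I * w := div_mul_cancel₀ _ hd
    have h4 : z ρ * (1 / 2 - Complex.I * ρ) = 1 / 2 + Complex.I * ρ := div_mul_cancel₀ _ h2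
    have h5 : (1 + a) * (1 / 2 + Complex.I * w) = 1 := by rw [add_mul, h3]; ring
    have h6 : (1 - a * z ρ) * (1 / 2 - Complex.I * ρ) = c * ((ρ : ℂ) - w) := by
      have h7 : (1 - a * z ρ) * (1 / 2 - Complex.I * ρ) * (1 / 2 + Complex.I * w) =
          c * ((ρ : ℂ) - w) * (1 / 2 + Complex.I * w) := by
        rw [hc]
        linear_combination (-(z ρ * (1 / 2 - Complex.I * ρ))) * h3
          - (1 / 2 - Complex.I * w) * h4 + Complex.I * ((ρ : ℂ) - w) * h5
      exact mul_right_cancel₀ hd h7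
    rw [← div_eq_mul_inv, ← div_eq_inv_mul, div_eq_div_iff h1 h2, h6]
  set R : ℕ → L2 := fun n => a ^ n • (memLp_zpow_mul n (memLp_kernel hw.ne)).toLp _ with hR
  have hsum : ∀ n, c • ∑ k ∈ Finset.range n, a ^ k • basisL2 k = kernelL2 w hw.ne - R n := by
    intro n
    induction n with
    | zero =>
      simp only [Finset.range_zero, Finset.sum_empty, smul_zero, hR, pow_zero, one_smul, one_mul]
      rw [kernelL2, sub_self]
    | succ n ih =>
      rw [Finset.sum_range_succ, smul_add, ih, sub_add, sub_right_inj, sub_eq_iff_eq_add]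
      simp only [hR, basisL2]
      rw [← MemLp.toLp_const_smul, ← MemLp.toLp_const_smul, ← MemLp.toLp_const_smul,
        ← MemLp.toLp_const_smul, ← MemLp.toLp_add]
      rw [MemLp.toLp_eq_toLp_iff]
      refine ae_of_all _ fun ρ => ?_
      simp only [Pi.smul_apply, Pi.add_apply, smul_eq_mul, basisFun]
      have := key ρ
      rw [div_eq_mul_inv]
      linear_combination (a ^ n * z ρ ^ n) * this
  have hRn : ∀ n, ‖R n‖ ≤ ‖a‖ ^ n * ‖kernelL2 w hw.ne‖ := by
    intro n
    simp only [hR]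
    rw [norm_smul, norm_pow]
    gcongr
    refine Lp.norm_le_norm_of_ae_le ?_
    filter_upwards [(memLp_zpow_mul n (memLp_kernel hw.ne)).coeFn_toLp,
      (memLp_kernel hw.ne).coeFn_toLp] with ρ h1 h2
    rw [h1, kernelL2, h2]
    simp [norm_z]
  have hR0 : Tendsto R atTop (𝓝 0) := by
    rw [tendsto_zero_iff_norm_tendsto_zero]
    refine squeeze_zero (fun _ => norm_nonneg _) hRn ?_
    simpa using (tendsto_pow_atTop_nhds_zero_of_lt_one (norm_nonneg a) hna).mul_const
      ‖kernelL2 w hw.ne‖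
  have hlim : Tendsto (fun n => c • ∑ k ∈ Finset.range n, a ^ k • basisL2 k) atTop
      (𝓝 (kernelL2 w hw.ne)) := by
    simp_rw [hsum]
    simpa using hR0.const_sub (kernelL2 w hw.ne)
  refine (Submodule.isClosed_topologicalClosure _).mem_of_tendsto hlim (Eventually.of_forall fun n => ?_)
  exact Submodule.smul_mem _ _ (Submodule.sum_mem _ fun k _ =>
    Submodule.smul_mem _ _ (basisL2_mem_closedSpan k))

theorem inner_eq_zero_of_mem_closedSpan {u : L2} (h : ∀ k, inner ℂ u (basisL2 k) = 0)
    {f : L2} (hf : f ∈ closedSpan) : inner ℂ u f = 0 := by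
  have hle : closedSpan ≤ (Submodule.span ℂ {u})ᗮ := by
    refine Submodule.topologicalClosure_minimal _ ?_ (Submodule.isClosed_orthogonal _)
    rw [Submodule.span_le]
    rintro _ ⟨k, rfl⟩
    rw [SetLike.mem_coe, Submodule.mem_orthogonal_singleton_iff_inner_right]
    exact h k
  exact (Submodule.mem_orthogonal_singleton_iff_inner_right).1 (hle hf)

/-- Cauchy integrals of elements of the closed span vanish in the lower half-plane. -/
theorem cauchyIntegral_of_mem {f : L2} (hf : f ∈ closedSpan) {w : ℂ} (hw : w.im < 0) :
    cauchyIntegral f w = 0 := by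
  rw [cauchyIntegral_eq_inner f w hw.ne]
  refine mul_eq_zero_of_right _ (inner_eq_zero_of_mem_closedSpan (fun k => ?_) hf)
  have hmem : MemLp (fun ρ => conj (basisFun k ρ)) 2 := (memLp_basisFun k).star
  have h1 : inner ℂ (hmem.toLp _) (kernelL2 w hw.ne) = 0 := by
    refine inner_eq_zero_of_mem_closedSpan (fun j => ?_) (kernelL2_mem_closedSpan hw)
    rw [L2.inner_def, ← integral_zpow_den (k + j)]
    refine integral_congr_ae ?_
    filter_upwards [hmem.coeFn_toLp, (memLp_basisFun j).coeFn_toLp] with ρ h1 h2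
    rw [basisL2, h1, h2]
    have := den_ne ρ
    simp only [RCLike.inner_apply, basisFun, Complex.conj_conj, pow_add]
    field_simp
  rw [← h1, L2.inner_def, L2.inner_def]
  refine integral_congr_ae ?_
  filter_upwards [hmem.coeFn_toLp, (memLp_basisFun k).coeFn_toLp, (memLp_kernel hw.ne).coeFn_toLp,
    (memLp_kernel (conj_im_ne hw.ne)).coeFn_toLp] with ρ h1 h2 h3 h4
  rw [basisL2, kernelL2, kernelL2, h1, h2, h3, h4]
  simp [RCLike.inner_apply, mul_comm]

/-- Cauchy integrals of elements orthogonal to the closed span vanish in the upper half-plane. -/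
theorem cauchyIntegral_of_mem_orthogonal {f : L2} (hf : f ∈ closedSpanᗮ) {w : ℂ} (hw : 0 < w.im) :
    cauchyIntegral f w = 0 := by
  rw [cauchyIntegral_eq_inner f w hw.ne']
  exact mul_eq_zero_of_right _ (hf _ (kernelL2_mem_closedSpan (by simpa using hw)))

theorem lintegral_poisson_mono {μ ν : Measure ℝ}
    (h : ∀ r : ℝ, μ (Metric.ball 0 r) ≤ ν (Metric.ball 0 r)) {ε : ℝ} (hε : 0 < ε) :
    ∫⁻ s, ENNReal.ofReal (ε * (s ^ 2 + ε ^ 2)⁻¹) ∂μ ≤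
      ∫⁻ s, ENNReal.ofReal (ε * (s ^ 2 + ε ^ 2)⁻¹) ∂ν := by
  have hm : Measurable (fun s : ℝ => ε * (s ^ 2 + ε ^ 2)⁻¹) := by fun_prop
  have h0 : ∀ s : ℝ, 0 ≤ ε * (s ^ 2 + ε ^ 2)⁻¹ := fun s => by positivity
  rw [lintegral_eq_lintegral_meas_lt μ (ae_of_all _ h0) hm.aemeasurable,
    lintegral_eq_lintegral_meas_lt ν (ae_of_all _ h0) hm.aemeasurable]
  refine setLIntegral_mono' measurableSet_Ioi fun t ht => ?_
  have ht : 0 < t := ht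
  have hset : {s : ℝ | t < ε * (s ^ 2 + ε ^ 2)⁻¹} = Metric.ball 0 (Real.sqrt (ε / t - ε ^ 2)) := by
    ext s
    have hs : 0 < s ^ 2 + ε ^ 2 := by positivity
    rw [Set.mem_ofPred_eq, ← div_eq_mul_inv, lt_div_iff₀ hs, mem_ball_zero_iff, Real.norm_eq_abs,
      Real.lt_sqrt (abs_nonneg s), sq_abs, lt_sub_iff_add_lt, lt_div_iff₀ ht, mul_comm]
  rw [hset]
  exact h _

theorem lintegral_poisson {ε : ℝ} (hε : 0 < ε) :
    ∫⁻ s : ℝ, ENNReal.ofReal (ε * (s ^ 2 + ε ^ 2)⁻¹) = ENNReal.ofReal Real.pi := by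
  have e : ∀ s : ℝ, ε * (s ^ 2 + ε ^ 2)⁻¹ = ε⁻¹ * (1 + (s / ε) ^ 2)⁻¹ := fun s => by
    have : ε ≠ 0 := hε.ne'
    have h1 : s ^ 2 + ε ^ 2 ≠ 0 := by positivity
    have h2 : 1 + (s / ε) ^ 2 ≠ 0 := by positivity
    field_simp
    ring
  simp_rw [e]
  rw [← ofReal_integral_eq_lintegral_ofReal
    ((integrable_inv_one_add_sq.comp_div hε.ne').const_mul _)
    (ae_of_all _ fun s => by positivity)]
  congr 1
  rw [integral_const_mul, Measure.integral_comp_div (fun s : ℝ => (1 + s ^ 2)⁻¹) ε,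
    integral_univ_inv_one_add_sq, abs_of_pos hε, smul_eq_mul, ← mul_assoc,
    inv_mul_cancel₀ hε.ne', one_mul]

theorem tendsto_poisson_zero {g : ℝ → ℝ} (hg0 : ∀ s, 0 ≤ g s) (hgl : LocallyIntegrable g)
    (hgi : Integrable (fun s => g s * (1 + s ^ 2)⁻¹))
    (hav : Tendsto (fun r => ⨍ s in Metric.closedBall (0 : ℝ) r, g s) (𝓝[>] 0) (𝓝 0)) :
    Tendsto (fun ε : ℝ => ∫ s, g s * (ε * (s ^ 2 + ε ^ 2)⁻¹)) (𝓝[>] 0) (𝓝 0) := by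
  have hgm : AEStronglyMeasurable g := hgl.aestronglyMeasurable
  rw [Metric.tendsto_nhds]
  intro κ hκ
  set δ : ℝ := κ / (2 * (Real.pi + 1)) with hδ
  have hpi := Real.pi_pos
  have hδ0 : 0 < δ := by positivity
  have hδπ : δ * Real.pi < κ / 2 := by
    rw [hδ, div_mul_eq_mul_div, div_lt_div_iff₀ (by positivity) (by norm_num)]
    nlinarith
  have hev := (Metric.tendsto_nhds.1 hav) δ hδ0
  rw [eventually_nhdsWithin_iff, Metric.eventually_nhds_iff] at hev
  obtain ⟨η', hη', hball⟩ := hev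
  set η := η' / 2 with hη
  have hη0 : 0 < η := by positivity
  have hball' : ∀ r, 0 < r → r ≤ η → ∫ s in Metric.closedBall (0 : ℝ) r, g s ≤ δ * (2 * r) := by
    intro r hr hrη
    have h1 := hball (y := r) (by rw [Real.dist_eq, sub_zero, abs_of_pos hr]; linarith) hr
    rw [Real.dist_eq, sub_zero, setAverage_eq, measureReal_def, Real.volume_closedBall,
      ENNReal.toReal_ofReal (by positivity), smul_eq_mul] at h1
    have h2 := lt_of_abs_lt h1
    rw [inv_mul_lt_iff₀ (by positivity)] at h2
    linarith
  -- near part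
  set μ : Measure ℝ := (volume.restrict (Metric.closedBall (0 : ℝ) η)).withDensity
    (fun s => ENNReal.ofReal (g s)) with hμ
  have hgη : IntegrableOn g (Metric.closedBall (0 : ℝ) η) :=
    hgl.integrableOn_isCompact (isCompact_closedBall _ _)
  have hμle : ∀ r : ℝ, μ (Metric.ball 0 r) ≤ (ENNReal.ofReal δ • volume) (Metric.ball (0 : ℝ) r) := by
    intro r
    rcases le_or_gt r 0 with hr | hr
    · simp [Metric.ball_eq_empty.2 hr]
    rw [hμ, withDensity_apply _ Metric.isOpen_ball.measurableSet,
      Measure.restrict_restrict Metric.isOpen_ball.measurableSet, Measure.smul_apply,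
      Real.volume_ball, smul_eq_mul, ← ENNReal.ofReal_mul hδ0.le]
    set m := min r η with hm
    have hm0 : 0 < m := lt_min hr hη0
    have hsub : Metric.ball (0 : ℝ) r ∩ Metric.closedBall 0 η ⊆ Metric.closedBall 0 m := by
      intro s hs
      rw [mem_closedBall_zero_iff]
      exact le_min (mem_ball_zero_iff.1 hs.1).le (mem_closedBall_zero_iff.1 hs.2)
    refine (lintegral_mono_set hsub).trans ?_
    rw [← ofReal_integral_eq_lintegral_ofReal
      (hgl.integrableOn_isCompact (isCompact_closedBall _ _)) (ae_of_all _ hg0)]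
    refine ENNReal.ofReal_le_ofReal ((hball' m hm0 (min_le_right _ _)).trans ?_)
    have : m ≤ r := min_le_left _ _
    gcongr
  have hnear : ∀ ε : ℝ, 0 < ε → ∫ s in Metric.closedBall (0 : ℝ) η, g s * (ε * (s ^ 2 + ε ^ 2)⁻¹)
      ≤ δ * Real.pi := by
    intro ε hε
    rw [integral_eq_lintegral_of_nonneg_ae
      (ae_of_all _ fun s => mul_nonneg (hg0 s) (by positivity))
      (hgη.aestronglyMeasurable.mul (by
        have : Measurable (fun s : ℝ => ε * (s ^ 2 + ε ^ 2)⁻¹) := by fun_prop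
        exact this.aestronglyMeasurable))]
    refine ENNReal.toReal_le_of_le_ofReal (by positivity) ?_
    have h1 := lintegral_poisson_mono hμle hε
    rw [lintegral_smul_measure, lintegral_poisson hε, smul_eq_mul, ← ENNReal.ofReal_mul hδ0.le,
      hμ, lintegral_withDensity_eq_lintegral_mul₀
        hgη.aestronglyMeasurable.aemeasurable.ennreal_ofReal
        (by fun_prop)] at h1
    refine le_trans (le_of_eq ?_) h1
    refine lintegral_congr fun s => ?_
    rw [Pi.mul_apply, ENNReal.ofReal_mul (hg0 s)]
  -- far part
  set C : ℝ := 1 + (η ^ 2)⁻¹ with hC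
  have hptw : ∀ ε : ℝ, 0 < ε → ∀ s ∈ (Metric.closedBall (0 : ℝ) η)ᶜ,
      g s * (ε * (s ^ 2 + ε ^ 2)⁻¹) ≤ ε * C * (g s * (1 + s ^ 2)⁻¹) := by
    intro ε hε s hs
    have hs' : η < |s| := by simpa using hs
    have hs2 : η ^ 2 ≤ s ^ 2 := by rw [← sq_abs s]; gcongr
    have hsp : 0 < s ^ 2 := lt_of_lt_of_le (by positivity) hs2
    have : (s ^ 2 + ε ^ 2)⁻¹ ≤ C * (1 + s ^ 2)⁻¹ := by
      rw [← div_eq_mul_inv, le_div_iff₀ (by positivity), ← div_eq_inv_mul,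
        div_le_iff₀ (by positivity), hC]
      have : 1 ≤ (η ^ 2)⁻¹ * s ^ 2 := by
        rw [← div_eq_inv_mul, one_le_div (by positivity)]; exact hs2
      have : 0 ≤ (η ^ 2)⁻¹ * ε ^ 2 := by positivity
      nlinarith [sq_nonneg ε]
    calc g s * (ε * (s ^ 2 + ε ^ 2)⁻¹) ≤ g s * (ε * (C * (1 + s ^ 2)⁻¹)) := by
          gcongr; exact hg0 s
      _ = _ := by ring
  have hint : ∀ ε : ℝ, 0 < ε → Integrable (fun s => g s * (ε * (s ^ 2 + ε ^ 2)⁻¹)) := by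
    intro ε hε
    have hmm : Measurable (fun s : ℝ => ε * (s ^ 2 + ε ^ 2)⁻¹) := by fun_prop
    refine (hgi.const_mul (ε * (1 + (ε ^ 2)⁻¹))).mono' (hgm.mul hmm.aestronglyMeasurable)
      (ae_of_all _ fun s => ?_)
    rw [Real.norm_of_nonneg (mul_nonneg (hg0 s) (by positivity))]
    have : (s ^ 2 + ε ^ 2)⁻¹ ≤ (1 + (ε ^ 2)⁻¹) * (1 + s ^ 2)⁻¹ := by
      rw [← div_eq_mul_inv, le_div_iff₀ (by positivity), ← div_eq_inv_mul,
        div_le_iff₀ (by positivity)]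
      have h1 : (ε ^ 2)⁻¹ * ε ^ 2 = 1 := inv_mul_cancel₀ (by positivity)
      have : 0 ≤ (ε ^ 2)⁻¹ * s ^ 2 := by positivity
      nlinarith [sq_nonneg ε]
    calc g s * (ε * (s ^ 2 + ε ^ 2)⁻¹)
        ≤ g s * (ε * ((1 + (ε ^ 2)⁻¹) * (1 + s ^ 2)⁻¹)) := by gcongr; exact hg0 s
      _ = _ := by ring
  set K : ℝ := C * ∫ s, g s * (1 + s ^ 2)⁻¹ with hK
  have hK0 : 0 ≤ K := mul_nonneg (by positivity)
    (integral_nonneg fun s => mul_nonneg (hg0 s) (by positivity))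
  have hfar : ∀ ε : ℝ, 0 < ε →
      ∫ s in (Metric.closedBall (0 : ℝ) η)ᶜ, g s * (ε * (s ^ 2 + ε ^ 2)⁻¹) ≤ ε * K := by
    intro ε hε
    have hb := (hgi.const_mul (ε * C))
    calc _ ≤ ∫ s in (Metric.closedBall (0 : ℝ) η)ᶜ, ε * C * (g s * (1 + s ^ 2)⁻¹) :=
          setIntegral_mono_on (hint ε hε).integrableOn hb.integrableOn
            Metric.isClosed_closedBall.measurableSet.compl (hptw ε hε)
      _ ≤ ∫ s, ε * C * (g s * (1 + s ^ 2)⁻¹) :=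
          setIntegral_le_integral hb (ae_of_all _ fun s =>
            mul_nonneg (by positivity) (mul_nonneg (hg0 s) (by positivity)))
      _ = ε * K := by rw [integral_const_mul, hK, mul_assoc]
  have hsmall : ∀ᶠ ε : ℝ in 𝓝[>] 0, ε < κ / (2 * (K + 1)) :=
    eventually_nhdsWithin_of_eventually_nhds (eventually_lt_nhds (by positivity))
  filter_upwards [hsmall, self_mem_nhdsWithin] with ε hεs hε
  have hε : 0 < ε := hε
  rw [Real.dist_eq, sub_zero, abs_of_nonneg
    (integral_nonneg fun s => mul_nonneg (hg0 s) (by positivity)),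
    ← integral_add_compl (Metric.isClosed_closedBall (x := (0:ℝ)) (ε := η)).measurableSet (hint ε hε)]
  have h1 := hnear ε hε
  have h2 := hfar ε hε
  rw [lt_div_iff₀ (by positivity)] at hεs
  nlinarith

theorem memLp_shift (f : L2) (ρ : ℝ) : MemLp (fun s => f (ρ + s)) 2 :=
  (Lp.memLp f).comp_measurePreserving (measurePreserving_add_left volume ρ)

theorem memLp_inv_one_add_sq : MemLp (fun s : ℝ => (1 + s ^ 2)⁻¹) 2 := by
  have hc : Continuous (fun s : ℝ => (1 + s ^ 2)⁻¹) :=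
    Continuous.inv₀ (by fun_prop) fun s => by positivity
  rw [memLp_two_iff_integrable_sq hc.aestronglyMeasurable]
  refine integrable_inv_one_add_sq.mono' (hc.pow 2).aestronglyMeasurable
    (ae_of_all _ fun s => ?_)
  rw [Real.norm_of_nonneg (by positivity), sq]
  refine mul_le_of_le_one_left (by positivity) (inv_le_one_of_one_le₀ ?_)
  nlinarith [sq_nonneg s]

theorem jump_eq (f : L2) (ρ : ℝ) {ε : ℝ} (hε : 0 < ε) :
    cauchyIntegral f (ρ + ε * Complex.I) - cauchyIntegral f (ρ - ε * Complex.I) =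
      (Real.pi : ℂ)⁻¹ * ∫ s : ℝ, f (ρ + s) * ((ε * (s ^ 2 + ε ^ 2)⁻¹ : ℝ) : ℂ) := by
  have h1 : (ρ + ε * Complex.I : ℂ).im ≠ 0 := by simpa using hε.ne'
  have h2 : (ρ - ε * Complex.I : ℂ).im ≠ 0 := by simpa using hε.ne'
  rw [cauchyIntegral, cauchyIntegral, ← mul_sub,
    ← integral_sub (integrable_div_sub f _ h1) (integrable_div_sub f _ h2),
    ← integral_add_left_eq_self _ ρ, ← integral_const_mul, ← integral_const_mul]
  refine integral_congr_ae (ae_of_all _ fun s => ?_)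
  have hn1 := sub_ne (ρ + s) h1
  have hn2 := sub_ne (ρ + s) h2
  have hpi : (Real.pi : ℂ) ≠ 0 := by exact_mod_cast Real.pi_ne_zero
  have hpos : ((s : ℂ) ^ 2 + (ε : ℂ) ^ 2) ≠ 0 := by
    have : (s ^ 2 + ε ^ 2 : ℝ) ≠ 0 := by positivity
    exact_mod_cast this
  have e1 : (((ρ + s : ℝ) : ℂ) - (ρ + ε * Complex.I)) * (((ρ + s : ℝ) : ℂ) - (ρ - ε * Complex.I))
      = (s : ℂ) ^ 2 + (ε : ℂ) ^ 2 := by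
    push_cast
    linear_combination (-(ε : ℂ) ^ 2) * Complex.I_sq
  have e2 : f (ρ + s) / (((ρ + s : ℝ) : ℂ) - (ρ + ε * Complex.I)) -
      f (ρ + s) / (((ρ + s : ℝ) : ℂ) - (ρ - ε * Complex.I)) =
      f (ρ + s) * (2 * ε * Complex.I) / ((s : ℂ) ^ 2 + (ε : ℂ) ^ 2) := by
    rw [div_sub_div _ _ hn1 hn2, e1]
    congr 1
    push_cast
    ring
  simp only
  rw [e2]
  push_cast
  have := Complex.I_ne_zero
  field_simp

/-- The boundary values of a Cauchy integral from above and from below differ by the density. -/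
theorem ae_tendsto_jump (f : L2) : ∀ᵐ ρ : ℝ, Tendsto (fun ε : ℝ =>
    cauchyIntegral f (ρ + ε * Complex.I) - cauchyIntegral f (ρ - ε * Complex.I))
    (𝓝[>] 0) (𝓝 (f ρ)) := by
  have hloc : LocallyIntegrable f := (Lp.memLp f).locallyIntegrable (by norm_num)
  filter_upwards [IsUnifLocDoublingMeasure.ae_tendsto_average_norm_sub volume hloc 1] with ρ hρ
  have hav := hρ (fun _ : ℝ => ρ) (fun r : ℝ => r) (l := 𝓝[>] 0) tendsto_id (by
    filter_upwards [self_mem_nhdsWithin] with r hr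
    have hr : 0 < r := hr
    exact Metric.mem_closedBall_self (by linarith))
  set g : ℝ → ℝ := fun s => ‖f (ρ + s) - f ρ‖ with hg
  have hgl : LocallyIntegrable g := fun x =>
    ((((memLp_shift f ρ).locallyIntegrable (by norm_num)).sub
      (locallyIntegrable_const (f ρ))) x).norm
  have hgi : Integrable (fun s => g s * (1 + s ^ 2)⁻¹) := by
    have h1 : Integrable (fun s => ‖f (ρ + s)‖ * (1 + s ^ 2)⁻¹) :=
      (memLp_shift f ρ).norm.integrable_mul memLp_inv_one_add_sq
    have h2 : Integrable (fun s : ℝ => ‖f ρ‖ * (1 + s ^ 2)⁻¹) :=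
      integrable_inv_one_add_sq.const_mul _
    refine (h1.add h2).mono' (hgl.aestronglyMeasurable.mul memLp_inv_one_add_sq.1)
      (ae_of_all _ fun s => ?_)
    rw [Real.norm_of_nonneg (mul_nonneg (norm_nonneg _) (by positivity)), Pi.add_apply, ← add_mul]
    gcongr
    exact norm_sub_le _ _
  have hav' : Tendsto (fun r => ⨍ s in Metric.closedBall (0 : ℝ) r, g s) (𝓝[>] 0) (𝓝 0) := by
    refine hav.congr fun r => ?_
    rw [setAverage_eq, setAverage_eq, measureReal_def, measureReal_def, Real.volume_closedBall,
      Real.volume_closedBall]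
    congr 1
    have hpre : (fun s : ℝ => ρ + s) ⁻¹' Metric.closedBall ρ r = Metric.closedBall 0 r := by
      ext s; simp
    rw [← hpre, hg]
    exact ((measurePreserving_add_left volume ρ).setIntegral_preimage_emb
      (measurableEmbedding_addLeft ρ) (fun y => ‖f y - f ρ‖) _).symm
  have hlim := (tendsto_poisson_zero (fun s => norm_nonneg _) hgl hgi hav').const_mul Real.pi⁻¹
  rw [mul_zero] at hlim
  rw [tendsto_iff_norm_sub_tendsto_zero]
  refine squeeze_zero' (Eventually.of_forall fun _ => norm_nonneg _) ?_ hlim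
  filter_upwards [self_mem_nhdsWithin] with ε hε
  have hε : 0 < ε := hε
  have hpi : (Real.pi : ℂ) ≠ 0 := by exact_mod_cast Real.pi_ne_zero
  have hPi : Integrable (fun s : ℝ => ε * (s ^ 2 + ε ^ 2)⁻¹) := by
    have := (integrable_poisson 0 ε hε.ne').const_mul ε
    simpa using this
  have hP1 : ∫ s : ℝ, ε * (s ^ 2 + ε ^ 2)⁻¹ = Real.pi := by
    rw [integral_eq_lintegral_of_nonneg_ae (ae_of_all _ fun s => by positivity)
      hPi.aestronglyMeasurable, lintegral_poisson hε, ENNReal.toReal_ofReal Real.pi_pos.le]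
  have hP2 : MemLp (fun s : ℝ => ((ε * (s ^ 2 + ε ^ 2)⁻¹ : ℝ) : ℂ)) 2 := by
    have hmm : Measurable (fun s : ℝ => ε * (s ^ 2 + ε ^ 2)⁻¹) := by fun_prop
    refine MemLp.ofReal (f := fun s : ℝ => ε * (s ^ 2 + ε ^ 2)⁻¹) ?_
    rw [memLp_two_iff_integrable_sq hmm.aestronglyMeasurable]
    refine (hPi.const_mul ε⁻¹).mono' (hmm.pow_const 2).aestronglyMeasurable
      (ae_of_all _ fun s => ?_)
    have h3 : ε * (s ^ 2 + ε ^ 2)⁻¹ ≤ ε⁻¹ := by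
      rw [← div_eq_mul_inv, div_le_iff₀ (by positivity)]
      have : ε⁻¹ * ε ^ 2 = ε := by field_simp
      have : 0 ≤ ε⁻¹ * s ^ 2 := by positivity
      nlinarith
    rw [Real.norm_of_nonneg (by positivity), sq]
    gcongr
  have hfi : Integrable (fun s : ℝ => f (ρ + s) * ((ε * (s ^ 2 + ε ^ 2)⁻¹ : ℝ) : ℂ)) :=
    (memLp_shift f ρ).integrable_mul hP2
  have hci : Integrable (fun s : ℝ => f ρ * ((ε * (s ^ 2 + ε ^ 2)⁻¹ : ℝ) : ℂ)) :=
    hPi.ofReal.const_mul _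
  have hfρ : f ρ = (Real.pi : ℂ)⁻¹ * ∫ s : ℝ, f ρ * ((ε * (s ^ 2 + ε ^ 2)⁻¹ : ℝ) : ℂ) := by
    rw [integral_const_mul, integral_complex_ofReal, hP1]
    field_simp
  rw [jump_eq f ρ hε]
  conv_lhs => rw [hfρ]
  rw [← mul_sub, ← integral_sub hfi hci, norm_mul, norm_inv, Complex.norm_real,
    Real.norm_of_nonneg Real.pi_pos.le]
  gcongr
  refine (norm_integral_le_integral_norm _).trans (le_of_eq (integral_congr_ae
    (ae_of_all _ fun s => ?_)))
  simp only
  rw [← sub_mul, norm_mul, Complex.norm_real, Real.norm_of_nonneg (by positivity)]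

/-- `UpperBoundaryValue g f`: for almost every real `ρ`,
`f ρ = lim_{ε → 0+} (1/2πi) ∫ g(τ) / (τ - (ρ + iε)) dτ`, that is, `f = P⁺ g`. -/
def UpperBoundaryValue (g f : ℝ → ℂ) : Prop :=
  ∀ᵐ ρ : ℝ, Tendsto (fun ε : ℝ => cauchyIntegral g (ρ + ε * Complex.I)) (𝓝[>] 0) (𝓝 (f ρ))

theorem UpperBoundaryValue.ae_eq {g f f' : ℝ → ℂ} (h : UpperBoundaryValue g f)
    (h' : UpperBoundaryValue g f') : f =ᵐ[volume] f' := by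
  filter_upwards [h, h'] with ρ h1 h2 using tendsto_nhds_unique h1 h2

theorem UpperBoundaryValue.congr {g f f' : ℝ → ℂ} (h : UpperBoundaryValue g f)
    (h' : f =ᵐ[volume] f') : UpperBoundaryValue g f' := by
  filter_upwards [h, h'] with ρ h1 h2
  rwa [← h2]

theorem upper_of_mem {f : L2} (hf : f ∈ closedSpan) : UpperBoundaryValue f f := by
  filter_upwards [ae_tendsto_jump f] with ρ h
  refine h.congr' ?_
  filter_upwards [self_mem_nhdsWithin] with ε hε
  have hε : 0 < ε := hε
  rw [cauchyIntegral_of_mem hf (w := ρ - ε * Complex.I) (by simpa using hε), sub_zero]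

theorem cauchyIntegral_add (f g : L2) {w : ℂ} (hw : w.im ≠ 0) :
    cauchyIntegral (f + g : L2) w = cauchyIntegral f w + cauchyIntegral g w := by
  simp only [cauchyIntegral_eq_inner _ w hw, inner_add_right, mul_add]

theorem cauchyIntegral_smul (c : ℂ) (f : L2) {w : ℂ} (hw : w.im ≠ 0) :
    cauchyIntegral (c • f : L2) w = c * cauchyIntegral f w := by
  simp only [cauchyIntegral_eq_inner _ w hw, inner_smul_right]
  ring

/-- The space `L₂⁺(ℝ) = P⁺(L₂(ℝ))`: all `f` in `L₂(ℝ)` of the form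
`f(ρ) = lim_{ε → 0+} (1/2πi) ∫ g(τ) / (τ - (ρ + iε)) dτ` with `g` in `L₂(ℝ)`. -/
noncomputable def hardyPlus : Submodule ℂ L2 where
  carrier := {f | ∃ g : L2, UpperBoundaryValue g f}
  zero_mem' := ⟨0, by
    refine UpperBoundaryValue.congr (f := 0) (ae_of_all _ fun ρ => ?_) (Lp.coeFn_zero _ _ _).symm
    refine tendsto_const_nhds.congr' ?_
    filter_upwards [self_mem_nhdsWithin] with ε hε
    have hε : 0 < ε := hε
    rw [cauchyIntegral_eq_inner _ _ (by simpa using hε.ne'), inner_zero_right, mul_zero]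
    rfl⟩
  add_mem' := by
    rintro f f' ⟨g, h⟩ ⟨g', h'⟩
    refine ⟨g + g', UpperBoundaryValue.congr (f := ⇑f + ⇑f') ?_ (Lp.coeFn_add f f').symm⟩
    filter_upwards [h, h'] with ρ h1 h2
    refine (h1.add h2).congr' ?_
    filter_upwards [self_mem_nhdsWithin] with ε hε
    have hε : 0 < ε := hε
    rw [cauchyIntegral_add _ _ (by simpa using hε.ne')]
  smul_mem' := by
    rintro c f ⟨g, h⟩
    refine ⟨c • g, UpperBoundaryValue.congr (f := c • ⇑f) ?_ (Lp.coeFn_smul c f).symm⟩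
    filter_upwards [h] with ρ h1
    refine (h1.const_mul c).congr' ?_
    filter_upwards [self_mem_nhdsWithin] with ε hε
    have hε : 0 < ε := hε
    rw [cauchyIntegral_smul _ _ (by simpa using hε.ne')]

instance : closedSpan.HasOrthogonalProjection := by
  have : CompleteSpace closedSpan :=
    (Submodule.isClosed_topologicalClosure _).completeSpace_coe
  infer_instance

theorem upper_projection (g : L2) : UpperBoundaryValue g (closedSpan.starProjection g) := by
  filter_upwards [upper_of_mem (closedSpan.starProjection_apply_mem g)] with ρ h
  refine h.congr' ?_
  filter_upwards [self_mem_nhdsWithin] with ε hε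
  have hε : 0 < ε := hε
  have h2 := cauchyIntegral_add (closedSpan.starProjection g) (g - closedSpan.starProjection g)
    (w := ρ + ε * Complex.I) (by simpa using hε.ne')
  rw [cauchyIntegral_of_mem_orthogonal (closedSpan.sub_starProjection_mem_orthogonal g)
    (by simpa using hε), add_zero, add_sub_cancel] at h2
  exact h2.symm

theorem hardyPlus_eq : hardyPlus = closedSpan := by
  ext f
  constructor
  · rintro ⟨g, hg⟩
    have : f = closedSpan.starProjection g := Lp.ext (hg.ae_eq (upper_projection g))
    rw [this]
    exact closedSpan.starProjection_apply_mem g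
  · exact fun hf => ⟨f, upper_of_mem hf⟩

instance : CompleteSpace hardyPlus := by
  rw [hardyPlus_eq]
  exact (Submodule.isClosed_topologicalClosure _).completeSpace_coe

noncomputable instance : Inner ℂ hardyPlus := InnerProductSpace.toInner

/-- The analytic projection `P⁺` of `L₂(ℝ)` onto `L₂⁺(ℝ)`; `projPlus_spec` is its integral formula. -/
noncomputable def projPlus : L2 →L[ℂ] L2 := hardyPlus.starProjection

theorem projPlus_eq : projPlus = closedSpan.starProjection := by
  unfold projPlus
  congr 1
  exact hardyPlus_eq

theorem projPlus_spec (g : L2) : UpperBoundaryValue g (projPlus g) := by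
  rw [projPlus_eq]
  exact upper_projection g

/-- The operator `P⁻ = P⁺ - I`, with the sign that its integral formula `projMinus_spec` gives it. -/
noncomputable def projMinus : L2 →L[ℂ] L2 := projPlus - ContinuousLinearMap.id ℂ L2

/-- `(P⁻ f)(ρ) = lim_{ε → 0+} (1/2πi) ∫ f(τ) / (τ - (ρ - iε)) dτ`. -/
theorem projMinus_spec (f : L2) : ∀ᵐ ρ : ℝ, Tendsto
    (fun ε : ℝ => cauchyIntegral f (ρ - ε * Complex.I)) (𝓝[>] 0) (𝓝 (projMinus f ρ)) := by
  filter_upwards [projPlus_spec f, ae_tendsto_jump f, Lp.coeFn_sub (projPlus f) f] with ρ h1 h2 h3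
  have h4 : projMinus f ρ = projPlus f ρ - f ρ := h3
  rw [h4]
  refine (h1.sub h2).congr fun ε => ?_
  ring

theorem memLp_symbol_mul (φ : C(OnePoint ℝ, ℂ)) (y : L2) :
    MemLp (fun τ : ℝ => φ τ * y τ) 2 := by
  have hφ : Continuous (fun τ : ℝ => φ τ) := φ.continuous.comp OnePoint.continuous_coe
  refine (Lp.memLp y).of_le_mul (c := ‖φ‖) (hφ.aestronglyMeasurable.mul (Lp.memLp y).1)
    (ae_of_all _ fun τ => ?_)
  rw [norm_mul]
  gcongr
  exact φ.norm_coe_le_norm τ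

/-- Multiplication by the symbol, `y ↦ φ y`, on `L₂(ℝ)`. -/
noncomputable def mulSymbol (φ : C(OnePoint ℝ, ℂ)) : L2 →L[ℂ] L2 :=
  LinearMap.mkContinuous
    { toFun := fun y => (memLp_symbol_mul φ y).toLp _
      map_add' := fun y y' => by
        rw [← MemLp.toLp_add, MemLp.toLp_eq_toLp_iff]
        filter_upwards [Lp.coeFn_add y y'] with τ h
        simp only [h, Pi.add_apply, mul_add]
      map_smul' := fun c y => by
        rw [RingHom.id_apply, ← MemLp.toLp_const_smul, MemLp.toLp_eq_toLp_iff]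
        filter_upwards [Lp.coeFn_smul c y] with τ h
        simp only [h, Pi.smul_apply, smul_eq_mul]
        ring }
    ‖φ‖ fun y => by
      refine Lp.norm_le_mul_norm_of_ae_le_mul ?_
      filter_upwards [(memLp_symbol_mul φ y).coeFn_toLp] with τ h
      simp only [LinearMap.coe_mk, AddHom.coe_mk]
      rw [h, norm_mul]
      gcongr
      exact φ.norm_coe_le_norm τ

theorem mulSymbol_ae (φ : C(OnePoint ℝ, ℂ)) (y : L2) :
    mulSymbol φ y =ᵐ[volume] fun τ => φ τ * y τ :=
  (memLp_symbol_mul φ y).coeFn_toLp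

/-- The reflection `(Jf)(ρ) = f(-ρ)` on `L₂(ℝ)`. -/
noncomputable def reflection : L2 →L[ℂ] L2 :=
  (Lp.compMeasurePreservingₗᵢ ℂ Neg.neg
    (Measure.measurePreserving_neg (volume : Measure ℝ))).toContinuousLinearMap

theorem reflection_ae (f : L2) : reflection f =ᵐ[volume] fun ρ => f (-ρ) :=
  Lp.coeFn_compMeasurePreserving f (Measure.measurePreserving_neg (volume : Measure ℝ))


theorem projMinus_mem_orthogonal (f : L2) : projMinus f ∈ closedSpanᗮ := by
  have h : projMinus f = -(f - closedSpan.starProjection f) := by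
    rw [projMinus, projPlus_eq]
    simp
  rw [h]
  exact Submodule.neg_mem _ (closedSpan.sub_starProjection_mem_orthogonal f)

theorem reflection_projMinus_mem (f : L2) : reflection (projMinus f) ∈ hardyPlus := by
  refine ⟨reflection (projMinus f), ?_⟩
  have hq := (Measure.measurePreserving_neg (volume : Measure ℝ)).quasiMeasurePreserving.ae
    (ae_tendsto_jump (projMinus f))
  filter_upwards [hq, reflection_ae (projMinus f)] with ρ h1 h2
  rw [h2]
  refine h1.congr' ?_
  filter_upwards [self_mem_nhdsWithin] with ε hε
  have hε : 0 < ε := hε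
  rw [cauchyIntegral_of_mem_orthogonal (projMinus_mem_orthogonal f)
    (w := (-ρ : ℝ) + ε * Complex.I) (by simpa using hε), zero_sub, cauchyIntegral, cauchyIntegral,
    ← mul_neg, ← integral_neg,
    ← integral_neg_eq_self (fun τ : ℝ => (reflection (projMinus f)) τ / (τ - (ρ + ε * Complex.I)))]
  congr 1
  refine integral_congr_ae ?_
  have hq' := (Measure.measurePreserving_neg (volume : Measure ℝ)).quasiMeasurePreserving.ae
    (reflection_ae (projMinus f))
  filter_upwards [hq'] with τ h
  rw [h, neg_neg, ← div_neg]
  congr 1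
  push_cast
  ring

/-- The Hankel operator `H(φ) = J P⁻ φ` on `L₂⁺(ℝ)`; `hankel_spec` is its integral formula
`(H(φ) y)(ρ) = (1/2πi) ∫ φ(τ) y(τ) / (τ + ρ + i0) dτ`. -/
noncomputable def hankel (φ : C(OnePoint ℝ, ℂ)) : hardyPlus →L[ℂ] hardyPlus :=
  (reflection ∘L projMinus ∘L mulSymbol φ ∘L hardyPlus.subtypeL).codRestrict hardyPlus
    fun _ => reflection_projMinus_mem _

/-- `(H(φ) y)(ρ) = lim_{ε → 0+} (1/2πi) ∫ φ(τ) y(τ) / (τ + (ρ + iε)) dτ`. -/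
theorem hankel_spec (φ : C(OnePoint ℝ, ℂ)) (y : hardyPlus) : ∀ᵐ ρ : ℝ, Tendsto
    (fun ε : ℝ => (2 * Real.pi * Complex.I)⁻¹ *
      ∫ τ : ℝ, φ τ * (y : L2) τ / ((τ : ℂ) + (ρ + ε * Complex.I)))
    (𝓝[>] 0) (𝓝 ((hankel φ y : L2) ρ)) := by
  have hq := (Measure.measurePreserving_neg (volume : Measure ℝ)).quasiMeasurePreserving.ae
    (projMinus_spec (mulSymbol φ y))
  filter_upwards [hq, reflection_ae (projMinus (mulSymbol φ y))] with ρ h1 h2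
  have h3 : (hankel φ y : L2) ρ = projMinus (mulSymbol φ y) (-ρ) := h2
  rw [h3]
  refine h1.congr fun ε => ?_
  rw [cauchyIntegral]
  congr 1
  refine integral_congr_ae ?_
  filter_upwards [mulSymbol_ae φ y] with τ h
  rw [h]
  congr 1
  push_cast
  ring

/-- The basis function `e_k(ρ) = z(ρ)^k / (1/2 - iρ)` as an element of `L₂⁺(ℝ)`. -/
noncomputable def basis (k : ℕ) : hardyPlus :=
  ⟨basisL2 k, by rw [hardyPlus_eq]; exact basisL2_mem_closedSpan k⟩

/-- `L₂⁺⁽ⁿ⁾(ℝ)`, the linear span of `e_0, …, e_{n-1}`. -/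
noncomputable def sectionSpace (n : ℕ) : Submodule ℂ hardyPlus :=
  Submodule.span ℂ (Set.range fun k : Fin n => basis k)

instance (n : ℕ) : FiniteDimensional ℂ (sectionSpace n) :=
  FiniteDimensional.span_of_finite ℂ (Set.finite_range _)

/-- The projection `P_n` of `L₂⁺(ℝ)` onto the span of `e_0, …, e_{n-1}`. -/
noncomputable def sectionProj (n : ℕ) : hardyPlus →L[ℂ] sectionSpace n :=
  (sectionSpace n).orthogonalProjectionOnto

theorem inner_basis_of_lt {j k : ℕ} (h : j < k) : inner ℂ (basis j) (basis k) = 0 := by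
  obtain ⟨n, rfl⟩ := Nat.exists_eq_add_of_lt h
  change inner ℂ (basisL2 j) (basisL2 (j + n + 1)) = 0
  rw [L2.inner_def, ← integral_zpow_den n]
  refine integral_congr_ae ?_
  filter_upwards [(memLp_basisFun j).coeFn_toLp, (memLp_basisFun (j + n + 1)).coeFn_toLp]
    with ρ h1 h2
  rw [basisL2, basisL2, h1, h2]
  have hz : conj (z ρ) * z ρ = 1 := by
    rw [← Complex.normSq_eq_conj_mul_self, Complex.normSq_eq_norm_sq, norm_z]; simp
  have hzj : conj (z ρ) ^ j * z ρ ^ j = 1 := by rw [← mul_pow, hz, one_pow]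
  have hd := den_ne ρ
  have hd' := num_ne ρ
  have hc : conj (1 / 2 - Complex.I * ρ : ℂ) = 1 / 2 + Complex.I * ρ := by
    simp [Complex.conj_ofNat]
  simp only [RCLike.inner_apply, basisFun, map_div₀, map_pow, hc]
  have hz1 : z ρ / (1 / 2 + Complex.I * ρ) = 1 / (1 / 2 - Complex.I * ρ) := by
    rw [z, div_div, div_eq_div_iff (mul_ne_zero hd hd') hd]
    ring
  calc z ρ ^ (j + n + 1) / (1 / 2 - Complex.I * ρ) * (conj (z ρ) ^ j / (1 / 2 + Complex.I * ρ))
      = z ρ ^ n * (conj (z ρ) ^ j * z ρ ^ j) * (z ρ / (1 / 2 + Complex.I * ρ)) *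
          (1 / (1 / 2 - Complex.I * ρ)) := by ring
    _ = z ρ ^ n * (1 / (1 / 2 - Complex.I * ρ) ^ 2) := by
        rw [hzj, hz1, sq, ← one_div_mul_one_div]; ring

theorem inner_basis_of_ne {j k : ℕ} (h : j ≠ k) : inner ℂ (basis j) (basis k) = 0 := by
  rcases lt_or_gt_of_ne h with h | h
  · exact inner_basis_of_lt h
  · rw [← inner_conj_symm, inner_basis_of_lt h, map_zero]

/-- `P_n` maps `∑_{k ≥ 0} f_k e_k` to `∑_{k < n} f_k e_k`. -/
theorem sectionProj_of_hasSum {c : ℕ → ℂ} {f : hardyPlus}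
    (h : HasSum (fun k => c k • basis k) f) (n : ℕ) :
    (sectionProj n f : hardyPlus) = ∑ k ∈ Finset.range n, c k • basis k := by
  refine Submodule.eq_starProjection_of_mem_of_inner_eq_zero ?_ ?_
  · refine Submodule.sum_mem _ fun k hk => Submodule.smul_mem _ _ (Submodule.subset_span ?_)
    exact ⟨⟨k, Finset.mem_range.1 hk⟩, rfl⟩
  · have hle : sectionSpace n ≤
        (Submodule.span ℂ {f - ∑ k ∈ Finset.range n, c k • basis k})ᗮ := by
      rw [sectionSpace, Submodule.span_le]
      rintro _ ⟨j, rfl⟩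
      rw [SetLike.mem_coe, Submodule.mem_orthogonal_singleton_iff_inner_left]
      have h1 : HasSum (fun k => inner ℂ (basis j) (c k • basis k)) (inner ℂ (basis (j : ℕ)) f) :=
        (innerSL ℂ (basis (j : ℕ))).hasSum h
      have h0 : ∀ k, k ≠ (j : ℕ) → inner ℂ (basis j) (c k • basis k) = 0 := fun k hk =>
        (inner_smul_right (𝕜 := ℂ) (basis (j : ℕ)) (basis k) (c k)).trans
          (mul_eq_zero_of_right _ (inner_basis_of_ne (Ne.symm hk)))
      have h2 : HasSum (fun k => inner ℂ (basis j) (c k • basis k))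
          (inner ℂ (basis (j : ℕ)) (c j • basis j)) :=
        hasSum_single _ h0
      rw [inner_sub_right, h1.unique h2, inner_sum, Finset.sum_eq_single (j : ℕ), sub_self]
      · exact fun k _ hk => h0 k hk
      · intro hj
        exact absurd (Finset.mem_range.2 j.2) hj
    intro w hw
    exact Submodule.mem_orthogonal_singleton_iff_inner_right.1 (hle hw)

/-- The truncated operator `P_n A P_n` on the span of `e_0, …, e_{n-1}`. -/
noncomputable def truncation (A : hardyPlus →L[ℂ] hardyPlus) (n : ℕ) :
    sectionSpace n →L[ℂ] sectionSpace n :=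
  sectionProj n ∘L A ∘L (sectionSpace n).subtypeL

/-- The finite section method, with respect to `(e_k)_{k ≥ 0}`, is applicable to `A`: the operators
`P_n A P_n` are invertible for all large `n` with uniformly bounded inverses, and for every `f` the
solutions `y_n` of `P_n A P_n y_n = P_n f` converge to a solution `y` of `A y = f`. -/
def FiniteSectionApplicable (A : hardyPlus →L[ℂ] hardyPlus) : Prop :=
  (∃ (N : ℕ) (C : ℝ), ∀ n ≥ N, IsUnit (truncation A n) ∧ ‖Ring.inverse (truncation A n)‖ ≤ C) ∧
  ∀ f : hardyPlus, ∃ y : hardyPlus, A y = f ∧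
    Tendsto (fun n => (Ring.inverse (truncation A n) (sectionProj n f) : hardyPlus)) atTop (𝓝 y)

/-- The entries `h_p` of the Hankel matrix `(h_{k+m})` of the system. -/
noncomputable def hankelEntry (φ : C(OnePoint ℝ, ℂ)) (p : ℕ) : ℂ :=
  (-1) ^ (p + 1) / (2 * Real.pi) *
    ∫ τ : ℝ, φ τ * z τ ^ (p + 1) / ((1 / 2 - Complex.I * τ) * (1 / 2 + Complex.I * τ))

/-- The right-hand side of the system that comes from the equation `(I + H(φ)) y = -H(φ)(1)`. -/
noncomputable def systemRhs (φ : C(OnePoint ℝ, ℂ)) (m : ℕ) : ℂ :=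
  (-1) ^ m / (2 * Real.pi) * ∫ τ : ℝ, φ τ * z τ ^ (m + 1) / (1 / 2 + Complex.I * τ)

/-- `a ∈ ℓ₂` solves the infinite system `a_m + ∑_{k ≥ 0} h_{k+m} a_k = r_m`, `m ≥ 0`. -/
def SolvesSystem (φ : C(OnePoint ℝ, ℂ)) (r a : ℕ → ℂ) : Prop :=
  Memℓp a 2 ∧ ∀ m, HasSum (fun k => hankelEntry φ (k + m) * a k) (r m - a m)

/-- `a` solves the reduced system `a_m + ∑_{k < n} h_{k+m} a_k = r_m`, `0 ≤ m < n`. -/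
def SolvesReducedSystem (φ : C(OnePoint ℝ, ℂ)) (r : ℕ → ℂ) (n : ℕ) (a : Fin n → ℂ) : Prop :=
  ∀ m : Fin n, a m + ∑ k : Fin n, hankelEntry φ (k + m) * a k = r m

end HankelSection

open HankelSection

/-!
The operator `H(φ)` is a norm limit of its truncations `P_n H(φ) P_n`, and this gives the theorem.

The function `conj e_m` is the reflection of `e_m` and is orthogonal to `L₂⁺(ℝ)`, so
`⟨e_m, H(φ) e_k⟩` is an integral of `φ z^(k+m+1)`; in the orthonormal basis `(-1)^k e_k / √(2π)` the
matrix of `H(φ)` is exactly `(h_{k+m})` (`inner_signedBasis_hankel`). Multiplying the symbol by `z`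
or `conj z` shifts the sequence `(h_p)`, which vanishes for `φ = 1`; hence every polynomial in `z`
and `conj z` gives a Hankel matrix with finitely many nonzero entries
(`eventually_hankelEntry_mul_eq_zero`), and such an operator equals its large truncations. Since
`z` is a homeomorphism of the one-point compactification of `ℝ` onto the unit circle, these
polynomials are uniformly dense by Stone–Weierstrass, and `‖H(φ)‖ ≤ ‖φ‖` transfers the
approximation to operators (`tendsto_truncation_hankel`).

Consequently `I + P_n H(φ) P_n` tends to `I + H(φ)` in norm. For large `n` it is invertible and its
inverse tends in norm to the inverse of `I + H(φ)`. It leaves `L₂⁺⁽ⁿ⁾(ℝ)` invariant and acts there as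
`P_n (I + H(φ)) P_n`, which yields the stability and the convergence of the finite section method
(`finiteSection_of_tendsto`). The statements on the infinite and the reduced systems are this result
in coordinates (`solvesSystem_iff`, `solvesReducedSystem_iff`). The right-hand side that comes from
`-H(φ)(1)` is square summable by Bessel's inequality (`memℓp_systemRhs`).
-/

namespace HankelSection

/-! ### Compressions of operators that differ from the identity by a limit of their truncations -/

section Abstract

variable {E : Type*} [NormedAddCommGroup E] [InnerProductSpace ℂ E]

/-- The operator `1 + P H P` leaves the range `U` of `P` invariant, where it coincides with the
compression of `1 + H`, and is the identity on `Uᗮ`; its inverse therefore restricts to the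
inverse of the compression. -/
theorem isUnit_compression (U : Submodule ℂ E) [U.HasOrthogonalProjection] (H : E →L[ℂ] E)
    (hT : IsUnit (1 + U.starProjection ∘L H ∘L U.starProjection)) :
    IsUnit (U.orthogonalProjectionOnto ∘L (1 + H) ∘L U.subtypeL) ∧
      ∀ u : U, ((Ring.inverse (U.orthogonalProjectionOnto ∘L (1 + H) ∘L U.subtypeL) u : U) : E) =
        Ring.inverse (1 + U.starProjection ∘L H ∘L U.starProjection) u := by
  set T : E →L[ℂ] E := 1 + U.starProjection ∘L H ∘L U.starProjection with hTdef
  set B : U →L[ℂ] U := U.orthogonalProjectionOnto ∘L (1 + H) ∘L U.subtypeL with hB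
  have hP : ∀ u : U, U.starProjection (u : E) = u := fun u =>
    Submodule.starProjection_eq_self_iff.2 u.2
  have hBT : ∀ u : U, ((B u : U) : E) = T u := by
    intro u
    change U.starProjection ((u : E) + H u) = (u : E) + U.starProjection (H (U.starProjection u))
    rw [map_add, hP]
  have hTT : ∀ x, T (Ring.inverse T x) = x := fun x =>
    DFunLike.congr_fun (Ring.mul_inverse_cancel T hT) x
  have hTT' : ∀ x, Ring.inverse T (T x) = x := fun x =>
    DFunLike.congr_fun (Ring.inverse_mul_cancel T hT) x
  have hmem : ∀ u : U, Ring.inverse T u ∈ U := by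
    intro u
    -- `T x = u` reads `x = u - P H P x`, and both terms on the right lie in `U`.
    have h := hTT u
    have h' : Ring.inverse T u =
        u - U.starProjection (H (U.starProjection (Ring.inverse T u))) := by
      rw [eq_sub_iff_add_eq]
      exact h
    rw [h']
    exact U.sub_mem u.2 (U.starProjection_apply_mem _)
  set S : U →L[ℂ] U := U.orthogonalProjectionOnto ∘L Ring.inverse T ∘L U.subtypeL with hS
  have hSc : ∀ u : U, ((S u : U) : E) = Ring.inverse T u := fun u =>
    Submodule.starProjection_eq_self_iff.2 (hmem u)
  have h1 : B * S = 1 := by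
    ext u
    change ((B (S u) : U) : E) = u
    rw [hBT, hSc, hTT]
  have h2 : S * B = 1 := by
    ext u
    change ((S (B u) : U) : E) = u
    rw [hSc, hBT, hTT']
  let V : (U →L[ℂ] U)ˣ := ⟨B, S, h1, h2⟩
  have hinv : Ring.inverse B = S := Ring.inverse_unit V
  exact ⟨V.isUnit, fun u => by rw [hinv, hSc]⟩

/-- Stability of the finite section method: when `P_n H P_n → H` in norm, `1 + P_n H P_n` is a
norm-small perturbation of the invertible operator `1 + H`, and inversion is continuous. -/
theorem finiteSection_of_tendsto [CompleteSpace E] (U : ℕ → Submodule ℂ E)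
    [∀ n, (U n).HasOrthogonalProjection] (H : E →L[ℂ] E)
    (hH : Tendsto (fun n => (U n).starProjection ∘L H ∘L (U n).starProjection) atTop (𝓝 H))
    (hU : ∀ f, Tendsto (fun n => (U n).starProjection f) atTop (𝓝 f)) (hA : IsUnit (1 + H)) :
    (∃ (N : ℕ) (C : ℝ), ∀ n ≥ N,
      IsUnit ((U n).orthogonalProjectionOnto ∘L (1 + H) ∘L (U n).subtypeL) ∧
        ‖Ring.inverse ((U n).orthogonalProjectionOnto ∘L (1 + H) ∘L (U n).subtypeL)‖ ≤ C) ∧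
    ∀ f : E, Tendsto (fun n => ((Ring.inverse
      ((U n).orthogonalProjectionOnto ∘L (1 + H) ∘L (U n).subtypeL)
        ((U n).orthogonalProjectionOnto f) : U n) : E)) atTop (𝓝 (Ring.inverse (1 + H) f)) := by
  set T : ℕ → E →L[ℂ] E := fun n => 1 + (U n).starProjection ∘L H ∘L (U n).starProjection with hT
  have hTlim : Tendsto T atTop (𝓝 (1 + H)) := hH.const_add 1
  have hunit : ∀ᶠ n in atTop, IsUnit (T n) := hTlim.eventually (Units.isOpen.mem_nhds hA)
  have hinv : Tendsto (fun n => Ring.inverse (T n)) atTop (𝓝 (Ring.inverse (1 + H))) := by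
    have h : ContinuousAt Ring.inverse (1 + H) := by
      simpa using NormedRing.inverse_continuousAt hA.unit
    exact h.tendsto.comp hTlim
  refine ⟨?_, fun f => ?_⟩
  · have hbd : ∀ᶠ n in atTop, ‖Ring.inverse (T n)‖ ≤ ‖Ring.inverse (1 + H)‖ + 1 :=
      hinv.norm.eventually_le_const (lt_add_one _)
    obtain ⟨N, hN⟩ := eventually_atTop.1 (hunit.and hbd)
    refine ⟨N, ‖Ring.inverse (1 + H)‖ + 1, fun n hn => ?_⟩
    obtain ⟨h1, h2⟩ := isUnit_compression (U n) H (hN n hn).1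
    refine ⟨h1, ContinuousLinearMap.opNorm_le_bound _ (by positivity) fun u => ?_⟩
    rw [← Submodule.norm_coe, h2, ← Submodule.norm_coe]
    exact ((Ring.inverse (T n)).le_opNorm u).trans (by gcongr; exact (hN n hn).2)
  · have hlim : Tendsto (fun n => Ring.inverse (T n) ((U n).starProjection f)) atTop
        (𝓝 (Ring.inverse (1 + H) f)) :=
      isBoundedBilinearMap_apply.continuous.tendsto _ |>.comp (hinv.prodMk_nhds (hU f))
    refine hlim.congr' ?_
    filter_upwards [hunit] with n hn
    exact ((isUnit_compression (U n) H hn).2 _).symm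

end Abstract

/-! ### The matrix of the Hankel operator -/

theorem conj_den (ρ : ℝ) : conj (1 / 2 - Complex.I * ρ : ℂ) = 1 / 2 + Complex.I * ρ := by
  simp [Complex.conj_ofNat]

theorem conj_z_mul_z (ρ : ℝ) : conj (z ρ) * z ρ = 1 := by
  rw [← Complex.normSq_eq_conj_mul_self, Complex.normSq_eq_norm_sq, norm_z]
  simp

theorem basisFun_neg (k : ℕ) (ρ : ℝ) : basisFun k (-ρ) = conj (basisFun k ρ) := by
  have h : conj (1 / 2 + Complex.I * ρ : ℂ) = 1 / 2 - Complex.I * ρ := by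
    rw [← conj_den, Complex.conj_conj]
  simp only [basisFun, z, map_div₀, map_pow, h, conj_den, Complex.ofReal_neg, mul_neg, sub_neg_eq_add,
    ← sub_eq_add_neg]

theorem memLp_conj_basisFun (k : ℕ) : MemLp (fun ρ => conj (basisFun k ρ)) 2 :=
  (memLp_basisFun k).star

/-- The complex conjugate of `e_k`, as an element of `L₂(ℝ)`. -/
noncomputable def conjBasisL2 (k : ℕ) : L2 := (memLp_conj_basisFun k).toLp _

theorem conjBasisL2_ae (k : ℕ) : conjBasisL2 k =ᵐ[volume] fun ρ => conj (basisFun k ρ) :=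
  (memLp_conj_basisFun k).coeFn_toLp

theorem basisL2_ae (k : ℕ) : basisL2 k =ᵐ[volume] basisFun k := (memLp_basisFun k).coeFn_toLp

theorem inner_conjBasisL2 (k : ℕ) (f : L2) :
    inner ℂ (conjBasisL2 k) f = ∫ τ : ℝ, f τ * basisFun k τ := by
  rw [L2.inner_def]
  refine integral_congr_ae ?_
  filter_upwards [conjBasisL2_ae k] with τ h
  rw [h, RCLike.inner_apply, Complex.conj_conj]

theorem basisFun_mul (j k : ℕ) (ρ : ℝ) :
    basisFun j ρ * basisFun k ρ = z ρ ^ (j + k) * (1 / (1 / 2 - Complex.I * ρ : ℂ) ^ 2) := by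
  rw [basisFun, basisFun, pow_add, sq, ← one_div_mul_one_div]
  ring

/-- The functions `conj e_k` lie in the lower Hardy space. -/
theorem inner_conjBasisL2_of_mem (k : ℕ) {f : L2} (hf : f ∈ hardyPlus) :
    inner ℂ (conjBasisL2 k) f = 0 := by
  rw [hardyPlus_eq] at hf
  refine inner_eq_zero_of_mem_closedSpan (fun j => ?_) hf
  rw [inner_conjBasisL2, ← integral_zpow_den (j + k)]
  refine integral_congr_ae ?_
  filter_upwards [basisL2_ae j] with ρ h
  rw [h, basisFun_mul]

theorem inner_basisL2_reflection (k : ℕ) (g : L2) :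
    inner ℂ (basisL2 k) (reflection g) = inner ℂ (conjBasisL2 k) g := by
  rw [inner_conjBasisL2, L2.inner_def,
    ← integral_neg_eq_self (fun τ : ℝ => g τ * basisFun k τ)]
  refine integral_congr_ae ?_
  filter_upwards [basisL2_ae k, reflection_ae g] with τ h1 h2
  rw [h1, h2, basisFun_neg, RCLike.inner_apply]

/-- Moving the reflection onto `e_m` turns it into `conj e_m`, which is orthogonal to the range of
`P⁺`, so that `P⁻ = P⁺ - I` acts as `-I` in the inner product. -/
theorem inner_basis_hankel_eq_integral (φ : C(OnePoint ℝ, ℂ)) (m : ℕ) (y : hardyPlus) :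
    inner ℂ (basis m) (hankel φ y) = -∫ τ : ℝ, φ τ * (y : L2) τ * basisFun m τ := by
  change inner ℂ (basisL2 m) (reflection (projMinus (mulSymbol φ y))) = _
  have h : projMinus (mulSymbol φ y) = projPlus (mulSymbol φ y) - mulSymbol φ y := rfl
  rw [inner_basisL2_reflection, h, inner_sub_right,
    inner_conjBasisL2_of_mem m (f := projPlus _) (hardyPlus.starProjection_apply_mem _), zero_sub,
    inner_conjBasisL2]
  congr 1
  refine integral_congr_ae ?_
  filter_upwards [mulSymbol_ae φ y] with τ h
  rw [h]

theorem basisFun_mul_eq (j k : ℕ) (τ : ℝ) : basisFun j τ * basisFun k τ =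
    z τ ^ (j + k + 1) / ((1 / 2 - Complex.I * τ) * (1 / 2 + Complex.I * τ)) := by
  have h1 := den_ne τ
  have h2 := num_ne τ
  have h : z τ ^ (j + k + 1) = z τ ^ (j + k) * ((1 / 2 + Complex.I * τ) / (1 / 2 - Complex.I * τ)) :=
    pow_succ _ _
  rw [basisFun_mul, h, ← mul_one_div _ (_ * _), ← one_div_mul_one_div, sq, ← one_div_mul_one_div,
    ← mul_one_div (1 / 2 + Complex.I * (τ : ℂ))]
  linear_combination (-(z τ ^ (j + k) * (1 / (1 / 2 - Complex.I * τ)) ^ 2)) *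
    mul_one_div_cancel h2

theorem inner_basis_hankel (φ : C(OnePoint ℝ, ℂ)) (m k : ℕ) :
    inner ℂ (basis m) (hankel φ (basis k)) =
      2 * Real.pi * (-1) ^ (k + m) * hankelEntry φ (k + m) := by
  have h : ∫ τ : ℝ, φ τ * (basis k : L2) τ * basisFun m τ =
      ∫ τ : ℝ, φ τ * z τ ^ (k + m + 1) / ((1 / 2 - Complex.I * τ) * (1 / 2 + Complex.I * τ)) := by
    refine integral_congr_ae ?_
    filter_upwards [basisL2_ae k] with τ h
    have h' : (basis k : L2) τ = basisFun k τ := h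
    rw [h', mul_assoc, basisFun_mul_eq, mul_div_assoc]
  have hpi : (Real.pi : ℂ) ≠ 0 := by exact_mod_cast Real.pi_ne_zero
  have hs : ((-1 : ℂ) ^ (k + m)) * (-1) ^ (k + m) = 1 := by rw [← mul_pow]; simp
  rw [inner_basis_hankel_eq_integral, h, hankelEntry, pow_succ (-1 : ℂ)]
  generalize (∫ τ : ℝ, φ τ * z τ ^ (k + m + 1) /
    ((1 / 2 - Complex.I * τ) * (1 / 2 + Complex.I * τ))) = x
  field_simp
  linear_combination x * hs

theorem inner_basis_self (k : ℕ) : inner ℂ (basis k) (basis k) = (2 * Real.pi : ℂ) := by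
  change inner ℂ (basisL2 k) (basisL2 k) = _
  have hi : ∫ τ : ℝ, (τ ^ 2 + (1 / 2) ^ 2)⁻¹ = 2 * Real.pi := by
    have e : ∀ s : ℝ, (s ^ 2 + (1 / 2) ^ 2)⁻¹ = 4 * (1 + (s / (1 / 2)) ^ 2)⁻¹ := fun s => by
      have h1 : s ^ 2 + (1 / 2) ^ 2 ≠ 0 := by positivity
      have h2 : 1 + (s / (1 / 2)) ^ 2 ≠ 0 := by positivity
      field_simp
      ring
    simp_rw [e]
    rw [integral_const_mul, Measure.integral_comp_div (fun s : ℝ => (1 + s ^ 2)⁻¹) (1 / 2),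
      integral_univ_inv_one_add_sq, abs_of_pos (by norm_num), smul_eq_mul]
    ring
  have hi' : ∫ τ : ℝ, (((τ ^ 2 + (1 / 2) ^ 2)⁻¹ : ℝ) : ℂ) = 2 * Real.pi := by
    rw [integral_complex_ofReal, hi]
    push_cast
    ring
  rw [L2.inner_def, ← hi']
  refine integral_congr_ae ?_
  filter_upwards [basisL2_ae k] with τ h
  have h1 := den_ne τ
  have h2 := num_ne τ
  have hz : z τ ^ k * conj (z τ) ^ k = 1 := by rw [← mul_pow, mul_comm, conj_z_mul_z, one_pow]
  have hp : ((τ : ℂ) ^ 2 + (1 / 2) ^ 2) ≠ 0 := by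
    have h : ((τ ^ 2 + (1 / 2) ^ 2 : ℝ) : ℂ) ≠ 0 := Complex.ofReal_ne_zero.2 (by positivity)
    push_cast at h
    exact h
  rw [h]
  simp only [RCLike.inner_apply, basisFun, map_div₀, map_pow, conj_den]
  rw [Complex.ofReal_inv]
  push_cast
  rw [div_mul_div_comm, hz, ← one_div]
  congr 1
  linear_combination (-(τ : ℂ) ^ 2) * Complex.I_sq

/-- The normalised functions `(-1)^k e_k / √(2π)`. The signs turn the matrix of the Hankel operator
into `(h_{k+m})`. -/
noncomputable def signedBasis (k : ℕ) : hardyPlus :=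
  ((-1) ^ k / (Real.sqrt (2 * Real.pi) : ℂ)) • basis k

theorem sqrt_two_pi_ne : (Real.sqrt (2 * Real.pi) : ℂ) ≠ 0 := by
  have : Real.sqrt (2 * Real.pi) ≠ 0 := (Real.sqrt_pos.2 (by positivity)).ne'
  exact_mod_cast this

theorem sqrt_two_pi_mul_self :
    (Real.sqrt (2 * Real.pi) : ℂ) * Real.sqrt (2 * Real.pi) = 2 * Real.pi := by
  rw [← Complex.ofReal_mul, Real.mul_self_sqrt (by positivity)]
  push_cast
  ring

theorem signedBasis_coeff_ne (k : ℕ) : ((-1) ^ k / (Real.sqrt (2 * Real.pi) : ℂ)) ≠ 0 :=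
  div_ne_zero (pow_ne_zero _ (by norm_num)) sqrt_two_pi_ne

theorem inner_smul_hardyPlus (d : ℂ) (x y : hardyPlus) :
    inner ℂ x (d • y) = d * inner ℂ x y :=
  inner_smul_right (𝕜 := ℂ) x y d

theorem inner_smul_smul_hardyPlus (c d : ℂ) (x y : hardyPlus) :
    inner ℂ (c • x) (d • y) = conj c * (d * inner ℂ x y) :=
  (inner_smul_left (𝕜 := ℂ) x (d • y) c).trans
    (congrArg (conj c * ·) (inner_smul_hardyPlus d x y))

theorem orthonormal_signedBasis : Orthonormal ℂ signedBasis := by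
  rw [orthonormal_iff_ite]
  intro j k
  simp only [signedBasis]
  rw [inner_smul_smul_hardyPlus]
  split_ifs with h
  · subst h
    have hs : ((-1 : ℂ) ^ j) * (-1) ^ j = 1 := by rw [← mul_pow]; simp
    have h0 := sqrt_two_pi_ne
    rw [inner_basis_self, ← sqrt_two_pi_mul_self]
    simp only [map_div₀, map_pow, map_neg, map_one, Complex.conj_ofReal]
    field_simp
    linear_combination hs
  · rw [inner_basis_of_ne h, mul_zero, mul_zero]

theorem inner_signedBasis_hankel (φ : C(OnePoint ℝ, ℂ)) (m k : ℕ) :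
    inner ℂ (signedBasis m) (hankel φ (signedBasis k)) = hankelEntry φ (k + m) := by
  have hs : ∀ j : ℕ, ((-1 : ℂ) ^ j) * (-1) ^ j = 1 := fun j => by rw [← mul_pow]; simp
  have h0 := sqrt_two_pi_ne
  simp only [signedBasis]
  rw [map_smul, inner_smul_smul_hardyPlus, inner_basis_hankel, ← sqrt_two_pi_mul_self]
  simp only [map_div₀, map_pow, map_neg, map_one, Complex.conj_ofReal, pow_add]
  field_simp
  linear_combination hankelEntry φ (k + m) * ((-1) ^ k * (-1) ^ k * hs m + hs k)

theorem span_signedBasis {ι : Type*} (e : ι → ℕ) :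
    Submodule.span ℂ (Set.range fun i => signedBasis (e i)) =
      Submodule.span ℂ (Set.range fun i => basis (e i)) := by
  apply le_antisymm <;> rw [Submodule.span_le] <;> rintro _ ⟨i, rfl⟩
  · exact Submodule.smul_mem _ _ (Submodule.subset_span ⟨i, rfl⟩)
  · refine (Submodule.smul_mem_iff _ (signedBasis_coeff_ne (e i))).1 ?_
    exact Submodule.subset_span ⟨i, rfl⟩

theorem span_basis_dense : (⊤ : Submodule ℂ hardyPlus) ≤
    (Submodule.span ℂ (Set.range signedBasis)).topologicalClosure := by
  have h := span_signedBasis id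
  simp only [id] at h
  change Submodule.span ℂ (Set.range signedBasis) = Submodule.span ℂ (Set.range basis) at h
  rw [h]
  rintro ⟨f, hf⟩ -
  have hf' := hf
  rw [hardyPlus_eq] at hf'
  rw [← SetLike.mem_coe, Submodule.topologicalClosure_coe, closure_subtype]
  have himg : ((↑) : hardyPlus → L2) '' (Submodule.span ℂ (Set.range basis) : Set hardyPlus) =
      (Submodule.span ℂ (Set.range basisL2) : Set L2) := by
    have h2 := Submodule.map_span hardyPlus.subtype (Set.range basis)
    rw [← Set.range_comp] at h2
    exact congrArg (fun S : Submodule ℂ L2 => (S : Set L2)) h2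
  rw [himg]
  exact hf'

/-- The functions `(-1)^k e_k / √(2π)` as a Hilbert basis of `L₂⁺(ℝ)`. -/
noncomputable def signedHilbertBasis : HilbertBasis ℕ ℂ hardyPlus :=
  HilbertBasis.mk orthonormal_signedBasis span_basis_dense

theorem coe_signedHilbertBasis : ⇑signedHilbertBasis = signedBasis := HilbertBasis.coe_mk _ _

/-! ### Coordinates and the projections `P_n` -/

theorem ext_inner_signedBasis {x y : hardyPlus}
    (h : ∀ m, inner ℂ (signedBasis m) x = inner ℂ (signedBasis m) y) : x = y := by
  refine signedHilbertBasis.repr.injective (lp.ext (funext fun m => ?_))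
  rw [signedHilbertBasis.repr_apply_apply, signedHilbertBasis.repr_apply_apply,
    coe_signedHilbertBasis, h]

theorem signedBasis_mem_sectionSpace {k n : ℕ} (h : k < n) : signedBasis k ∈ sectionSpace n :=
  Submodule.smul_mem _ _ (Submodule.subset_span ⟨⟨k, h⟩, rfl⟩)

theorem starProjection_signedBasis_of_lt {k n : ℕ} (h : k < n) :
    (sectionSpace n).starProjection (signedBasis k) = signedBasis k :=
  Submodule.starProjection_eq_self_iff.2 (signedBasis_mem_sectionSpace h)

theorem starProjection_signedBasis_of_le {k n : ℕ} (h : n ≤ k) :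
    (sectionSpace n).starProjection (signedBasis k) = 0 := by
  have hs : HasSum (fun j => (if j = k then 1 else 0 : ℂ) • basis j) (basis k) := by
    have := hasSum_single (f := fun j => (if j = k then 1 else 0 : ℂ) • basis j) k
      (fun j hj => by simp [hj])
    simpa using this
  have h1 : (sectionSpace n).starProjection (basis k) = _ := sectionProj_of_hasSum hs n
  rw [signedBasis, map_smul, h1, Finset.sum_eq_zero, smul_zero]
  intro j hj
  have : j ≠ k := by have := Finset.mem_range.1 hj; omega
  simp [this]

theorem inner_signedBasis_starProjection_of_lt {m n : ℕ} (h : m < n) (x : hardyPlus) :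
    inner ℂ (signedBasis m) ((sectionSpace n).starProjection x) = inner ℂ (signedBasis m) x := by
  rw [← Submodule.inner_starProjection_left_eq_right, starProjection_signedBasis_of_lt h]

theorem inner_signedBasis_starProjection_of_le {m n : ℕ} (h : n ≤ m) (x : hardyPlus) :
    inner ℂ (signedBasis m) ((sectionSpace n).starProjection x) = 0 := by
  rw [← Submodule.inner_starProjection_left_eq_right, starProjection_signedBasis_of_le h,
    inner_zero_left]

theorem tendsto_starProjection_sectionSpace (f : hardyPlus) :
    Tendsto (fun n => (sectionSpace n).starProjection f) atTop (𝓝 f) := by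
  have h : HasSum (fun k => (signedHilbertBasis.repr f k *
      ((-1) ^ k / (Real.sqrt (2 * Real.pi) : ℂ))) • basis k) f := by
    refine (signedHilbertBasis.hasSum_repr f).congr_fun ?_
    intro k
    rw [coe_signedHilbertBasis, signedBasis, smul_smul]
  exact h.tendsto_sum_nat.congr fun n => (sectionProj_of_hasSum h n).symm

/-! ### Hankel operators with continuous symbol are limits of their truncations -/

theorem mulSymbol_add (φ ψ : C(OnePoint ℝ, ℂ)) : mulSymbol (φ + ψ) = mulSymbol φ + mulSymbol ψ := by
  ext1 y
  refine Lp.ext ?_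
  filter_upwards [mulSymbol_ae (φ + ψ) y, mulSymbol_ae φ y, mulSymbol_ae ψ y,
    Lp.coeFn_add (mulSymbol φ y) (mulSymbol ψ y)] with τ h1 h2 h3 h4
  have h4' : ((mulSymbol φ + mulSymbol ψ) y : L2) τ = mulSymbol φ y τ + mulSymbol ψ y τ := h4
  rw [h1, h4', h2, h3, ContinuousMap.add_apply, add_mul]

theorem hankel_add (φ ψ : C(OnePoint ℝ, ℂ)) : hankel (φ + ψ) = hankel φ + hankel ψ := by
  ext1 y
  apply Subtype.ext
  change reflection (projMinus (mulSymbol (φ + ψ) y)) =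
    reflection (projMinus (mulSymbol φ y)) + reflection (projMinus (mulSymbol ψ y))
  rw [mulSymbol_add, ← map_add, ← map_add]
  rfl

theorem norm_reflection (f : L2) : ‖reflection f‖ = ‖f‖ :=
  (Lp.compMeasurePreservingₗᵢ ℂ Neg.neg
    (Measure.measurePreserving_neg (volume : Measure ℝ))).norm_map f

theorem norm_projMinus_le (f : L2) : ‖projMinus f‖ ≤ ‖f‖ := by
  have h : projMinus f = -(hardyPlusᗮ.starProjection f) := by
    rw [Submodule.starProjection_orthogonal]
    exact (neg_sub f (projPlus f)).symm
  rw [h, norm_neg]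
  exact Submodule.norm_starProjection_apply_le _ f

theorem norm_mulSymbol_le (φ : C(OnePoint ℝ, ℂ)) : ‖mulSymbol φ‖ ≤ ‖φ‖ :=
  LinearMap.mkContinuous_norm_le _ (norm_nonneg _) _

theorem norm_hankel_le (φ : C(OnePoint ℝ, ℂ)) : ‖hankel φ‖ ≤ ‖φ‖ := by
  refine ContinuousLinearMap.opNorm_le_bound _ (norm_nonneg _) fun y => ?_
  change ‖reflection (projMinus (mulSymbol φ y))‖ ≤ ‖φ‖ * ‖(y : L2)‖
  rw [norm_reflection]
  exact (norm_projMinus_le _).trans ((mulSymbol φ).le_of_opNorm_le (norm_mulSymbol_le φ) _)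

theorem hankelEntry_add (φ ψ : C(OnePoint ℝ, ℂ)) (p : ℕ) :
    hankelEntry (φ + ψ) p = hankelEntry φ p + hankelEntry ψ p := by
  have h : ∀ χ : C(OnePoint ℝ, ℂ), hankelEntry χ p =
      inner ℂ (signedBasis p) (hankel χ (signedBasis 0)) := fun χ => by
    rw [inner_signedBasis_hankel, zero_add]
  rw [h, h, h, hankel_add, ← inner_add_right]
  rfl

theorem hankelEntry_algebraMap_mul (c : ℂ) (φ : C(OnePoint ℝ, ℂ)) (p : ℕ) :
    hankelEntry (algebraMap ℂ C(OnePoint ℝ, ℂ) c * φ) p = c * hankelEntry φ p := by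
  rw [hankelEntry, hankelEntry, mul_left_comm c, ← integral_const_mul c]
  congr 2
  funext τ
  have : (algebraMap ℂ C(OnePoint ℝ, ℂ) c * φ) (τ : OnePoint ℝ) = c * φ τ := rfl
  rw [this]
  ring

/-- The symbol `1` has zero Hankel operator, as `z^p / (1/2 - iτ)²` has a primitive that takes the
same value at both ends of the line. -/
theorem hankelEntry_one (p : ℕ) : hankelEntry 1 p = 0 := by
  rw [hankelEntry, ← mul_zero ((-1 : ℂ) ^ (p + 1) / (2 * Real.pi)), ← integral_zpow_den p]
  congr 2
  funext τ
  have := basisFun_mul_eq p 0 τ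
  rw [basisFun_mul, add_zero] at this
  rw [this, ContinuousMap.one_apply, one_mul]

/-- The function `z`, extended by `z(∞) = -1` to the one-point compactification of `ℝ`. -/
noncomputable def zSymbol : C(OnePoint ℝ, ℂ) :=
  OnePoint.continuousMapMk ⟨z, continuous_z⟩ (-1) <| by
    rw [coclosedCompact_eq_cocompact]
    exact tendsto_z _ tendsto_norm_cocompact_atTop

theorem zSymbol_coe (τ : ℝ) : zSymbol τ = z τ := rfl

theorem hankelEntry_zSymbol_mul (φ : C(OnePoint ℝ, ℂ)) (p : ℕ) :
    hankelEntry (zSymbol * φ) p = -hankelEntry φ (p + 1) := by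
  rw [hankelEntry, hankelEntry, pow_succ (-1 : ℂ) (p + 1), mul_neg_one, neg_div, neg_mul, neg_neg]
  congr 2
  funext τ
  rw [ContinuousMap.mul_apply, zSymbol_coe]
  ring

theorem hankelEntry_star_zSymbol_mul (φ : C(OnePoint ℝ, ℂ)) (p : ℕ) :
    hankelEntry (star zSymbol * φ) (p + 1) = -hankelEntry φ p := by
  rw [hankelEntry, hankelEntry, pow_succ (-1 : ℂ) (p + 1), mul_neg_one, neg_div, neg_mul]
  congr 3
  funext τ
  have h : (star zSymbol : C(OnePoint ℝ, ℂ)) (τ : OnePoint ℝ) = conj (z τ) := rfl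
  rw [ContinuousMap.mul_apply, h]
  congr 1
  linear_combination (φ τ * z τ ^ (p + 1)) * conj_z_mul_z τ

/-- Multiplication by a polynomial in `z` and `conj z` preserves the symbols whose Hankel matrix
has only finitely many nonzero entries, since `z` and `conj z` shift the entries. -/
theorem eventually_hankelEntry_mul_eq_zero {ψ : C(OnePoint ℝ, ℂ)}
    (hψ : ψ ∈ StarAlgebra.adjoin ℂ {zSymbol}) {φ : C(OnePoint ℝ, ℂ)}
    (hφ : ∀ᶠ p in atTop, hankelEntry φ p = 0) :
    ∀ᶠ p in atTop, hankelEntry (ψ * φ) p = 0 := by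
  rw [← StarSubalgebra.mem_toSubalgebra, StarAlgebra.adjoin_toSubalgebra] at hψ
  induction hψ using Algebra.adjoin_induction generalizing φ with
  | mem x hx =>
    rcases hx with rfl | hx
    · filter_upwards [(tendsto_add_atTop_nat 1).eventually hφ] with p hp
      rw [hankelEntry_zSymbol_mul, hp, neg_zero]
    · rw [Set.star_singleton, Set.mem_singleton_iff] at hx
      subst hx
      obtain ⟨K, hK⟩ := eventually_atTop.1 hφ
      refine eventually_atTop.2 ⟨K + 1, fun p hp => ?_⟩
      obtain ⟨q, rfl⟩ : ∃ q, p = q + 1 := ⟨p - 1, by omega⟩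
      rw [hankelEntry_star_zSymbol_mul, hK q (by omega), neg_zero]
  | algebraMap c =>
    filter_upwards [hφ] with p hp
    rw [hankelEntry_algebraMap_mul, hp, mul_zero]
  | add x y _ _ hx hy =>
    filter_upwards [hx hφ, hy hφ] with p h1 h2
    rw [add_mul, hankelEntry_add, h1, h2, add_zero]
  | mul x y _ _ hx hy =>
    simp only [mul_assoc]
    exact hx (hy hφ)

theorem z_injective : Function.Injective z := by
  intro a b h
  rw [z, z, div_eq_div_iff (den_ne a) (den_ne b)] at h
  have h2 : Complex.I * (a : ℂ) = Complex.I * b := by linear_combination h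
  exact_mod_cast mul_left_cancel₀ Complex.I_ne_zero h2

theorem z_ne_neg_one (ρ : ℝ) : z ρ ≠ -1 := by
  intro h
  rw [z, div_eq_iff (den_ne ρ)] at h
  have : (1 : ℂ) = 0 := by linear_combination h
  exact one_ne_zero this

theorem zSymbol_injective : Function.Injective zSymbol := by
  intro a b h
  induction a using OnePoint.rec with
  | infty =>
    induction b using OnePoint.rec with
    | infty => rfl
    | coe b => exact absurd h.symm (z_ne_neg_one b)
  | coe a =>
    induction b using OnePoint.rec with
    | infty => exact absurd h (z_ne_neg_one a)
    | coe b => rw [z_injective h]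

theorem dense_trigPolynomials :
    Dense (StarAlgebra.adjoin ℂ {zSymbol} : Set C(OnePoint ℝ, ℂ)) := by
  have h := ContinuousMap.starSubalgebra_topologicalClosure_eq_top_of_separatesPoints
    (StarAlgebra.adjoin ℂ {zSymbol}) (fun a b hab =>
      ⟨zSymbol, ⟨zSymbol, StarAlgebra.self_mem_adjoin_singleton ℂ zSymbol, rfl⟩,
        fun h => hab (zSymbol_injective h)⟩)
  rw [dense_iff_closure_eq, ← StarSubalgebra.topologicalClosure_coe, h]
  rfl

/-- A Hankel operator whose matrix has finitely many nonzero entries coincides with its large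
truncations. -/
theorem truncation_hankel_eq {ψ : C(OnePoint ℝ, ℂ)} {n : ℕ} (h : ∀ p ≥ n, hankelEntry ψ p = 0) :
    (sectionSpace n).starProjection ∘L hankel ψ ∘L (sectionSpace n).starProjection = hankel ψ := by
  have hd : Dense (Submodule.span ℂ (Set.range signedBasis) : Set hardyPlus) := by
    have := signedHilbertBasis.dense_span
    rw [coe_signedHilbertBasis] at this
    exact (Submodule.dense_iff_topologicalClosure_eq_top).2 this
  refine ContinuousLinearMap.ext_on hd ?_
  rintro _ ⟨k, rfl⟩
  refine ext_inner_signedBasis fun m => ?_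
  rw [ContinuousLinearMap.comp_apply, ContinuousLinearMap.comp_apply]
  rcases lt_or_ge k n with hk | hk
  · rw [starProjection_signedBasis_of_lt hk]
    rcases lt_or_ge m n with hm | hm
    · rw [inner_signedBasis_starProjection_of_lt hm]
    · rw [inner_signedBasis_starProjection_of_le hm, inner_signedBasis_hankel, h _ (by omega)]
  · rw [starProjection_signedBasis_of_le hk, map_zero, map_zero, inner_zero_right,
      inner_signedBasis_hankel, h _ (by omega)]

/-- The truncations of a Hankel operator with continuous symbol converge to it in norm, by density of
the polynomials in `z` and `conj z` among the symbols. -/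
theorem tendsto_truncation_hankel (φ : C(OnePoint ℝ, ℂ)) :
    Tendsto (fun n => (sectionSpace n).starProjection ∘L hankel φ ∘L
      (sectionSpace n).starProjection) atTop (𝓝 (hankel φ)) := by
  refine (Metric.tendsto_nhds (α := hardyPlus →L[ℂ] hardyPlus)).2 fun ε hε => ?_
  obtain ⟨ψ, hψ, hdist⟩ := Metric.mem_closure_iff.1 (dense_trigPolynomials φ) (ε / 2) (by positivity)
  have hev := eventually_hankelEntry_mul_eq_zero (φ := 1) hψ (Eventually.of_forall hankelEntry_one)
  rw [mul_one] at hev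
  obtain ⟨K, hK⟩ := eventually_atTop.1 hev
  filter_upwards [eventually_ge_atTop K] with n hn
  set P := (sectionSpace n).starProjection
  have hP : ‖P‖ ≤ 1 := Submodule.starProjection_norm_le _
  have hψn : P ∘L hankel ψ ∘L P = hankel ψ := truncation_hankel_eq fun p hp => hK p (by omega)
  have hs : hankel φ = hankel (φ - ψ) + hankel ψ := by rw [← hankel_add, sub_add_cancel]
  -- The truncation error of `H(φ)` is that of `H(φ - ψ)`, which is small in norm.
  have he : P ∘L hankel φ ∘L P - hankel φ = P ∘L hankel (φ - ψ) ∘L P - hankel (φ - ψ) := by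
    rw [hs, ContinuousLinearMap.add_comp, ContinuousLinearMap.comp_add, hψn]
    abel
  have hn1 : ‖hankel (φ - ψ)‖ < ε / 2 :=
    (norm_hankel_le _).trans_lt (by rwa [dist_eq_norm] at hdist)
  have hn2 : ‖P ∘L hankel (φ - ψ) ∘L P‖ ≤ ‖hankel (φ - ψ)‖ := by
    calc _ ≤ ‖P‖ * (‖hankel (φ - ψ)‖ * ‖P‖) :=
          (P.opNorm_comp_le _).trans (by gcongr; exact ContinuousLinearMap.opNorm_comp_le _ _)
      _ ≤ 1 * (‖hankel (φ - ψ)‖ * 1) := by gcongr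
      _ = _ := by ring
  refine (dist_eq_norm (P ∘L hankel φ ∘L P) (hankel φ)).trans_lt ?_
  rw [he]
  exact (norm_sub_le (P ∘L hankel (φ - ψ) ∘L P) (hankel (φ - ψ))).trans_lt
    ((add_lt_add (hn2.trans_lt hn1) hn1).trans_eq (add_halves ε))

/-! ### The reduced systems and the infinite system -/

theorem finiteSection_hankel (φ : C(OnePoint ℝ, ℂ)) (hφ : IsUnit (1 + hankel φ)) :
    (∃ (N : ℕ) (C : ℝ), ∀ n ≥ N, IsUnit (truncation (1 + hankel φ) n) ∧
      ‖Ring.inverse (truncation (1 + hankel φ) n)‖ ≤ C) ∧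
    ∀ f : hardyPlus, Tendsto
      (fun n => (Ring.inverse (truncation (1 + hankel φ) n) (sectionProj n f) : hardyPlus)) atTop
      (𝓝 (Ring.inverse (1 + hankel φ) f)) :=
  finiteSection_of_tendsto sectionSpace (hankel φ) (tendsto_truncation_hankel φ)
    tendsto_starProjection_sectionSpace hφ

/-- The element `∑_{k < n} b_k (-1)^k e_k / √(2π)` of `L₂⁺⁽ⁿ⁾(ℝ)`. -/
noncomputable def sectionSum (n : ℕ) (b : Fin n → ℂ) : sectionSpace n :=
  ⟨∑ k : Fin n, b k • signedBasis k, Submodule.sum_mem _ fun k _ =>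
    Submodule.smul_mem _ _ (signedBasis_mem_sectionSpace k.2)⟩

theorem inner_sectionSum {n : ℕ} (b : Fin n → ℂ) (m : Fin n) :
    inner ℂ (signedBasis m) (sectionSum n b : hardyPlus) = b m :=
  (orthonormal_signedBasis.comp _ Fin.val_injective).inner_right_fintype b m

theorem sectionSum_injective (n : ℕ) : Function.Injective (sectionSum n) := by
  intro b c h
  funext m
  rw [← inner_sectionSum b m, h, inner_sectionSum]

theorem sectionSum_surjective (n : ℕ) : Function.Surjective (sectionSum n) := by
  rintro ⟨x, hx⟩
  rw [sectionSpace, ← span_signedBasis (fun k : Fin n => (k : ℕ)),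
    Submodule.mem_span_range_iff_exists_fun] at hx
  obtain ⟨c, hc⟩ := hx
  exact ⟨c, Subtype.ext hc⟩

theorem ext_inner_sectionSpace {n : ℕ} {x y : sectionSpace n}
    (h : ∀ m : Fin n, inner ℂ (signedBasis m) (x : hardyPlus) =
      inner ℂ (signedBasis m) (y : hardyPlus)) : x = y := by
  refine Subtype.ext (ext_inner_signedBasis fun m => ?_)
  rcases lt_or_ge m n with hm | hm
  · exact h ⟨m, hm⟩
  · rw [← Submodule.starProjection_eq_self_iff.2 x.2, ← Submodule.starProjection_eq_self_iff.2 y.2,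
      inner_signedBasis_starProjection_of_le hm, inner_signedBasis_starProjection_of_le hm]

/-- The reduced system is the equation `P_n (I + H(φ)) P_n x = P_n g` in coordinates. -/
theorem solvesReducedSystem_iff (φ : C(OnePoint ℝ, ℂ)) (r : ℕ → ℂ) (n : ℕ) (b : Fin n → ℂ)
    {g : hardyPlus} (hg : ∀ m : Fin n, inner ℂ (signedBasis m) g = r m) :
    SolvesReducedSystem φ r n b ↔
      truncation (1 + hankel φ) n (sectionSum n b) = sectionProj n g := by
  have hl : ∀ m : Fin n,
      inner ℂ (signedBasis m) (truncation (1 + hankel φ) n (sectionSum n b) : hardyPlus) =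
        b m + ∑ k : Fin n, hankelEntry φ (k + m) * b k := by
    intro m
    have h1 : inner ℂ (signedBasis m) (truncation (1 + hankel φ) n (sectionSum n b) : hardyPlus) =
        inner ℂ (signedBasis m) ((sectionSum n b : hardyPlus) + hankel φ (sectionSum n b)) :=
      inner_signedBasis_starProjection_of_lt m.2 _
    have h2 : hankel φ (sectionSum n b) = ∑ k : Fin n, b k • hankel φ (signedBasis k) := by
      change hankel φ (∑ k : Fin n, b k • signedBasis k) = _
      rw [map_sum]
      simp only [map_smul]
    rw [h1, inner_add_right, inner_sectionSum, h2, inner_sum]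
    congr 1
    refine Finset.sum_congr rfl fun k _ => ?_
    rw [← inner_signedBasis_hankel, mul_comm, inner_smul_hardyPlus]
  have hr : ∀ m : Fin n, inner ℂ (signedBasis m) (sectionProj n g : hardyPlus) = r m := fun m =>
    (inner_signedBasis_starProjection_of_lt m.2 g).trans (hg m)
  constructor
  · intro h
    refine ext_inner_sectionSpace fun m => ?_
    rw [hl, hr, h m]
  · intro h m
    rw [← hl, h, hr]

theorem existsUnique_solvesReducedSystem (φ : C(OnePoint ℝ, ℂ)) {n : ℕ}
    (hn : IsUnit (truncation (1 + hankel φ) n)) (r : ℕ → ℂ) :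
    ∃! b : Fin n → ℂ, SolvesReducedSystem φ r n b := by
  -- Only `r_0, …, r_{n-1}` enter, so any `r` is realised by an element of `L₂⁺⁽ⁿ⁾(ℝ)`.
  have hg := inner_sectionSum (n := n) fun m => r m
  simp only [solvesReducedSystem_iff φ r n _ hg]
  set B := truncation (1 + hankel φ) n
  set f := sectionProj n (sectionSum n fun m => r m : hardyPlus)
  have hB : ∀ x, B (Ring.inverse B x) = x := fun x =>
    DFunLike.congr_fun (Ring.mul_inverse_cancel B hn) x
  have hB' : ∀ x, Ring.inverse B (B x) = x := fun x =>
    DFunLike.congr_fun (Ring.inverse_mul_cancel B hn) x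
  obtain ⟨b, hb⟩ := sectionSum_surjective n (Ring.inverse B f)
  refine ⟨b, by simp only [hb, hB], fun c hc => sectionSum_injective n ?_⟩
  rw [hb, ← hB' (sectionSum n c), hc]

theorem inner_signedBasis_of_hasSum {a : ℕ → ℂ} {y : hardyPlus}
    (h : HasSum (fun k => a k • signedBasis k) y) (m : ℕ) : inner ℂ (signedBasis m) y = a m := by
  have h1 : HasSum (fun k => inner ℂ (signedBasis m) (a k • signedBasis k))
      (inner ℂ (signedBasis m) y) := (innerSL ℂ (signedBasis m)).hasSum h
  have h2 : ∀ k, inner ℂ (signedBasis m) (a k • signedBasis k) = if m = k then a k else 0 := by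
    intro k
    rw [inner_smul_hardyPlus, orthonormal_iff_ite.1 orthonormal_signedBasis]
    simp
  simp only [h2] at h1
  refine h1.unique ?_
  simpa using hasSum_single (f := fun k => if m = k then a k else 0) m
    (fun k hk => if_neg (Ne.symm hk))

theorem hasSum_hankelEntry_mul (φ : C(OnePoint ℝ, ℂ)) {a : ℕ → ℂ} {y : hardyPlus}
    (h : HasSum (fun k => a k • signedBasis k) y) (m : ℕ) :
    HasSum (fun k => hankelEntry φ (k + m) * a k) (inner ℂ (signedBasis m) (hankel φ y)) := by
  have h1 := (innerSL ℂ (signedBasis m) ∘L hankel φ).hasSum h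
  refine h1.congr_fun fun k => ?_
  rw [← inner_signedBasis_hankel, mul_comm]
  change _ = inner ℂ (signedBasis m) (hankel φ (a k • signedBasis k))
  rw [map_smul, inner_smul_hardyPlus]

theorem exists_hasSum_signedBasis {a : ℕ → ℂ} (ha : Memℓp a 2) :
    ∃ y : hardyPlus, HasSum (fun k => a k • signedBasis k) y := by
  refine ⟨signedHilbertBasis.repr.symm ⟨a, ha⟩, ?_⟩
  have h := signedHilbertBasis.hasSum_repr_symm ⟨a, ha⟩
  rwa [coe_signedHilbertBasis] at h

theorem hasSum_inner_signedBasis (y : hardyPlus) :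
    HasSum (fun k => inner ℂ (signedBasis k) y • signedBasis k) y := by
  have h := signedHilbertBasis.hasSum_repr y
  simp only [signedHilbertBasis.repr_apply_apply, coe_signedHilbertBasis] at h
  exact h

theorem memℓp_inner_signedBasis (y : hardyPlus) :
    Memℓp (fun k => inner ℂ (signedBasis k) y) 2 := by
  have h := (signedHilbertBasis.repr y).2
  have h' : ((signedHilbertBasis.repr y : lp (fun _ : ℕ => ℂ) 2) : ℕ → ℂ) =
      fun k => inner ℂ (signedBasis k) y := by
    funext k
    rw [signedHilbertBasis.repr_apply_apply, coe_signedHilbertBasis]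
  rwa [h'] at h

/-- The infinite system is the equation `(I + H(φ)) y = g` in coordinates. -/
theorem solvesSystem_iff (φ : C(OnePoint ℝ, ℂ)) {r a : ℕ → ℂ} {g y : hardyPlus}
    (hg : HasSum (fun k => r k • signedBasis k) g) (hy : HasSum (fun k => a k • signedBasis k) y) :
    SolvesSystem φ r a ↔ (1 + hankel φ) y = g := by
  have hA : ∀ m, inner ℂ (signedBasis m) ((1 + hankel φ) y) =
      a m + inner ℂ (signedBasis m) (hankel φ y) := by
    intro m
    rw [← inner_signedBasis_of_hasSum hy m, ← inner_add_right]
    rfl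
  constructor
  · intro h
    refine ext_inner_signedBasis fun m => ?_
    rw [hA, (hasSum_hankelEntry_mul φ hy m).unique (h.2 m), inner_signedBasis_of_hasSum hg]
    ring
  · intro h
    refine ⟨?_, fun m => ?_⟩
    · have := memℓp_inner_signedBasis y
      simpa only [inner_signedBasis_of_hasSum hy] using this
    · have h1 := hA m
      rw [h, inner_signedBasis_of_hasSum hg] at h1
      rw [h1, add_sub_cancel_left]
      exact hasSum_hankelEntry_mul φ hy m

theorem smul_basis_eq (k : ℕ) (c : ℂ) : ((-1) ^ k * c) • basis k =
    (Real.sqrt (2 * Real.pi) : ℂ) • c • signedBasis k := by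
  have h := sqrt_two_pi_ne
  rw [signedBasis, smul_smul, smul_smul]
  congr 1
  field_simp

/-! ### The right-hand side `-H(φ)(1)` -/

/-- Up to sign and the factor `2π`, the numbers `r_m` are the coefficients of `φ` along the
orthogonal system `conj e_m`, so that Bessel's inequality applies. -/
theorem memℓp_systemRhs (φ : C(OnePoint ℝ, ℂ)) (hφ : MemLp (fun τ : ℝ => φ τ) 2) :
    Memℓp (systemRhs φ) 2 := by
  set f : L2 := hφ.star.toLp _
  have hfa : f =ᵐ[volume] fun τ : ℝ => conj (φ τ) := hφ.star.coeFn_toLp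
  -- In terms of `f = conj φ` the coefficients are taken along the `e_m` themselves.
  have horth : Orthonormal ℂ fun k => (signedBasis k : L2) := orthonormal_signedBasis
  have hint : ∀ m, inner ℂ f (basisL2 m) =
      ∫ τ : ℝ, φ τ * z τ ^ (m + 1) / (1 / 2 + Complex.I * τ) := by
    intro m
    rw [L2.inner_def]
    refine integral_congr_ae ?_
    filter_upwards [hfa, basisL2_ae m] with τ h1 h2
    have h3 := den_ne τ
    have h4 := num_ne τ
    rw [h1, h2, RCLike.inner_apply, Complex.conj_conj, basisFun, pow_succ]
    -- `z / (1/2 + iτ) = 1 / (1/2 - iτ)`, so only one of the factors `z` is unfolded.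
    nth_rw 3 [z]
    rw [div_mul_eq_mul_div, mul_comm, ← mul_assoc, mul_div_assoc (φ τ * z τ ^ m),
      div_right_comm, div_self h4, mul_one_div, mul_div_assoc, mul_comm]
  have hc : ∀ m, systemRhs φ m = (Real.sqrt (2 * Real.pi) : ℂ)⁻¹ *
      inner ℂ f (signedBasis m : L2) := by
    intro m
    have h1 : inner ℂ f (signedBasis m : L2) =
        (-1) ^ m / (Real.sqrt (2 * Real.pi) : ℂ) * inner ℂ f (basisL2 m) :=
      inner_smul_right f (basisL2 m) _
    have h0 := sqrt_two_pi_ne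
    rw [h1, hint, systemRhs, ← sqrt_two_pi_mul_self, ← mul_assoc]
    congr 1
    rw [← div_eq_inv_mul, div_div]
  refine memℓp_gen ?_
  have hb := (horth.inner_products_summable f).mul_left (‖(Real.sqrt (2 * Real.pi) : ℂ)⁻¹‖ ^ 2)
  refine hb.congr fun m => ?_
  rw [hc, norm_mul, ENNReal.toReal_ofNat, Real.rpow_two, mul_pow, ← norm_inner_symm f]

end HankelSection

open HankelSection
theorem mainTheorem1 (φ : C(OnePoint ℝ, ℂ)) (hφ : IsUnit (1 + hankel φ)) :
    FiniteSectionApplicable (1 + hankel φ) ∧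
    (∃ N : ℕ, ∀ n ≥ N, ∀ r : ℕ → ℂ, ∃! b : Fin n → ℂ, SolvesReducedSystem φ r n b) ∧
    (∀ r : ℕ → ℂ, Memℓp r 2 → ∃ a : ℕ → ℂ, SolvesSystem φ r a ∧
      (∀ a', SolvesSystem φ r a' → a' = a) ∧
      ∃ y : hardyPlus, HasSum (fun k => ((-1) ^ k * a k) • basis k) y ∧
        ∀ b : (n : ℕ) → Fin n → ℂ, (∀ᶠ n in atTop, SolvesReducedSystem φ r n (b n)) →
          Tendsto (fun n => ∑ k : Fin n, ((-1) ^ (k : ℕ) * b n k) • basis k) atTop (𝓝 y)) ∧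
    (MemLp (fun τ : ℝ => φ τ) 2 → Memℓp (systemRhs φ) 2) := by
  obtain ⟨hstable, hconv⟩ := finiteSection_hankel φ hφ
  have hA : ∀ x, (1 + hankel φ) (Ring.inverse (1 + hankel φ) x) = x := fun x =>
    DFunLike.congr_fun (Ring.mul_inverse_cancel _ hφ) x
  have hA' : ∀ x, Ring.inverse (1 + hankel φ) ((1 + hankel φ) x) = x := fun x =>
    DFunLike.congr_fun (Ring.inverse_mul_cancel _ hφ) x
  obtain ⟨N, C, hN⟩ := hstable
  refine ⟨⟨⟨N, C, hN⟩, fun f => ⟨Ring.inverse (1 + hankel φ) f, hA f, hconv f⟩⟩,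
    ⟨N, fun n hn => existsUnique_solvesReducedSystem φ (hN n hn).1⟩, fun r hr => ?_,
    memℓp_systemRhs φ⟩
  obtain ⟨g, hg⟩ := exists_hasSum_signedBasis hr
  set y := Ring.inverse (1 + hankel φ) g with hy
  have hysum := hasSum_inner_signedBasis y
  refine ⟨fun k => inner ℂ (signedBasis k) y, (solvesSystem_iff φ hg hysum).2 (hA g),
    fun a' ha' => ?_, (Real.sqrt (2 * Real.pi) : ℂ) • y, ?_, fun b hb => ?_⟩
  · obtain ⟨y', hy'⟩ := exists_hasSum_signedBasis ha'.1
    have h : y' = y := by rw [hy, ← (solvesSystem_iff φ hg hy').1 ha', hA']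
    funext k
    rw [← inner_signedBasis_of_hasSum hy' k, h]
  · simp only [smul_basis_eq]
    exact hysum.const_smul _
  · simp only [smul_basis_eq, ← Finset.smul_sum]
    refine Tendsto.const_smul ?_ _
    refine (hconv g).congr' ?_
    filter_upwards [hb, eventually_ge_atTop N] with n hbn hn
    have h1 := (solvesReducedSystem_iff φ r n (b n)
      fun m => inner_signedBasis_of_hasSum hg m).1 hbn
    have h2 : Ring.inverse (truncation (1 + hankel φ) n)
        (truncation (1 + hankel φ) n (sectionSum n (b n))) = sectionSum n (b n) :=
      DFunLike.congr_fun (Ring.inverse_mul_cancel _ (hN n hn).1) _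
    rw [← h1, h2]
    rfl
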